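/- **Setting.** Let $S,U^p,U^a$ be finite nonempty sets, $p(\cdot\mid\theta,u^p,u^a)$ a transition kernel on $S$ and $\kappa:S\times U^p\times U^a\to\mathbb R^d$ a reward function. Let $K\subset\mathbb R^d$ be compact and contain the convex hull of the range of $\kappa$ (so that averages of rewards lie in $K$), and let $D\subset K$ be nonempty with convex closure $\bar D$. Let $\Pi^p$ (resp. $\Pi^a$) be the set of maps from $S$ to probability distributions on $U^p$ (resp. $U^a$). Assume that for all fixed $\pi^p\in\Pi^p$, $\pi^a\in\Pi^a$ the induced Markov chain on $S$ is ergodic (irreducibility suffices), with stationary distribution $\eta^{(\pi^p,\pi^a)}$, and put $$\bar\kappa(\pi^p,\pi^a)=\sum_{\theta,u^p,u^a}\kappa(\theta,u^p,u^a)\,\eta^{(\pi^p,\pi^a)}(\theta)\,\pi^p(u^p|\theta)\,\pi^a(u^a|\theta),\qquad R(\pi^p)=\{\bar\kappa(\pi^p,\pi^a):\pi^a\in\Pi^a\}.$$ For $x\in\mathbb R^d$ let $x_{\bar D}$ be the point of $\bar D$ closest to $x$. Assume that for every $x\in K\setminus\bar D$ there is $\pi^p_x\in\Pi^p$ with $\inf_{\pi^a}\langle\bar\kappa(\pi^p_x,\pi^a)-x_{\bar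 D},\,x_{\bar D}-x\rangle>0$. **Scheme.** A scheme consists of the following choices: a strategy $\pi^p_0\in\Pi^p$; for each $x\in K\setminus\bar D$ a strategy $\pi^p_x$ and a radius $\rho(x)>0$ with $\inf_{y\in B(x,\rho(x))}\inf_{\pi^a}\langle\bar\kappa(\pi^p_x,\pi^a)-y_{\bar D},\,y_{\bar D}-y\rangle>0$; for each $n\ge0$ a finite set $\mathcal Q_n\subset K_n:=\{y\in K:\operatorname{dist}(y,D)\in[\frac1{n+1},\frac1n]\}$ (with $\frac10=\infty$) such that the balls $B(q,\rho(q)/2)$, $q\in\mathcal Q_n$, cover $K_n$; an injection $I:\mathcal Q:=\bigcup_n\mathcal Q_n\to\mathbb N$; and durations $T(q)$, $q\in\mathcal Q$, with $\frac{\rho(q)}{4v_{\max}}<T(q)<\frac{\rho(q)}{3v_{\max}}$, where $v_{\max}=\sup_{x\in K,\theta,u^p,u^a}\|\kappa(\theta,u^p,u^a)-x\|$. For $x\in K\setminus\bar D$ let $Q(x)$ be the $q\in\mathcal Q$ of least $I(q)$ with $x\in B(q,\rho(q)/2)$. **Play.** The average reward is $x_{n+1}=x_n+\frac1{n+1}[\kappa(\theta_n,u^p_n,u^a_n)-x_n]$,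 $x_0\in K$. The switching times are $s_0=0$ and: if $x_{s_n}\in\bar D$, the player uses $\pi^p_0$ at time $s_n$ and $s_{n+1}=s_n+1$; if $x_{s_n}\notin\bar D$, then with $q=Q(x_{s_n})$ he uses $\pi^p_q$ at the times $s_n,\dots,s_{n+1}-1$, where $s_{n+1}=\min\{m:\sum_{i=s_n}^{m-1}\frac1i>T(q)\}$ (the term $i=0$ is omitted). At each time the adversary chooses a strategy in $\Pi^a$ depending arbitrarily on the past (states up to and actions before that time, and possibly private randomness); given the past, the two actions are drawn independently from the current strategies, and then the next state from $p$. **Exceptional set.** Let $t(n)=\sum_{i=1}^n\frac1i$, let $\bar x$ be the linear interpolation with $\bar x(t(n))=x_n$, and for $t\ge0$ put $\bar y_m(t)=\bar x(\min\{t(s_m)+t,\;t(s_{m+1})\})$. For $q\in\mathcal Q$, $k\ge0$, $0\le j<2^k$ and $h=2^{-k}T(q)$, let $N(q,j,k)$ be the set of sequences $(x_n)$ for which there are a subsequence $(s_{m(n)})$ of the switching times with $x_{s_{m(n)}}\in K\setminus\bar D$ and $Q(x_{s_{m(n)}})=q$ for all $n$, and a limit $\bar y$ of $\bar y_{m(n)}$,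 uniform on compact subsets of $[0,\infty)$, such that $$\frac{\bar y((j+1)h)-e^{-h}\,\bar y(jh)}{1-e^{-h}}\notin\overline{R(\pi^p_q)}.$$ Let $N=\bigcup_{q,k,j}N(q,j,k)$. **Theorem.** A scheme exists. If the player follows any scheme, then, whatever the adversary does, almost surely $(x_n)\notin N$; and whenever $(x_n)\notin N$, every limit point of $(x_n)$ lies in $\bar D$. In particular, almost surely every limit point of the average reward $(x_n)$ lies in $\bar D$. -/

import Mathlib

open MeasureTheory Filter Topology

noncomputable section

namespace Approach

/-- The reward space `ℝ^d` with its Euclidean norm and inner product. -/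
abbrev Vec (d : ℕ) : Type := EuclideanSpace ℝ (Fin d)

/-- A (stationary, randomized) strategy: each state is mapped to a probability
distribution on the action set `U`. -/
abbrev Strategy (S U : Type*) [Fintype U] : Type _ := S → stdSimplex ℝ U

/-- The data of the problem: the transition kernel `p(· | θ, a, b)`, the one-step reward
`κ(θ, a, b)`, the reward set `K` and the target set `D`. -/
structure Game (S Up Ua : Type*) [Fintype S] (d : ℕ) where
  p : S → Up → Ua → stdSimplex ℝ S
  κ : S → Up → Ua → Vec d
  K : Set (Vec d)
  D : Set (Vec d)

namespace Game

variable {S Up Ua : Type*} [Fintype S] [Fintype Up] [Fintype Ua] {d : ℕ}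
variable (G : Game S Up Ua d)

/-- The transition matrix of the state when both players use fixed strategies. -/
def transition (πp : Strategy S Up) (πa : Strategy S Ua) : Matrix S S ℝ :=
  fun θ θ' => ∑ a, ∑ b, πp θ a * πa θ b * G.p θ a b θ'

/-- `η` is a stationary probability vector of the matrix `P`. -/
def IsStationary (P : Matrix S S ℝ) (η : S → ℝ) : Prop :=
  η ∈ stdSimplex ℝ S ∧ Matrix.vecMul η P = η

open Classical in
/-- The stationary distribution `η^{(πp, πa)}`. It exists for every stochastic matrix, and is
unique when the chain is irreducible. -/
def stationary (πp : Strategy S Up) (πa : Strategy S Ua) : S → ℝ :=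
  if h : ∃ η, IsStationary (G.transition πp πa) η then h.choose else 0

/-- The long-run average reward `κ̄(πp, πa)`. -/
def meanReward (πp : Strategy S Up) (πa : Strategy S Ua) : Vec d :=
  ∑ θ, ∑ a, ∑ b, (G.stationary πp πa θ * πp θ a * πa θ b) • G.κ θ a b

/-- The set `R(πp)` of long-run average rewards against all adversary strategies. -/
def rewardSet (πp : Strategy S Up) : Set (Vec d) :=
  Set.range fun πa : Strategy S Ua => G.meanReward πp πa

/-- Ergodicity for every fixed pair of strategies, in the sense of irreducibility
(aperiodicity is not required). -/
def Ergodic : Prop :=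
  ∀ (πp : Strategy S Up) (πa : Strategy S Ua), (G.transition πp πa).IsIrreducible

/-- `x_{D̄}`: the point of the closure of `D` closest to `x` (it exists and is unique when `D` is
nonempty with convex closure). -/
def proj (x : Vec d) : Vec d :=
  Classical.epsilon fun y => y ∈ closure G.D ∧ ∀ z ∈ closure G.D, ‖x - y‖ ≤ ‖x - z‖

/-- The separation assumption: for every `x ∈ K \ D̄` some player strategy `πp` satisfies
`inf_{πa} ⟪κ̄(πp, πa) - x_{D̄}, x_{D̄} - x⟫ > 0`. -/
def Separation : Prop :=
  ∀ x ∈ G.K \ closure G.D, ∃ πp : Strategy S Up, ∃ ε > 0, ∀ πa : Strategy S Ua,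
    ε ≤ inner ℝ (G.meanReward πp πa - G.proj x) (G.proj x - x)

/-- The layer `K_n = {y ∈ K : dist(y, D) ∈ [1/(n+1), 1/n]}`, where `1/0 = ∞`, so that the
layers cover `K \ D̄`. -/
def layer (n : ℕ) : Set (Vec d) :=
  {y ∈ G.K | 1 / ((n : ℝ) + 1) ≤ Metric.infDist y G.D ∧
    (n ≠ 0 → Metric.infDist y G.D ≤ 1 / (n : ℝ))}

/-- `v_max = sup_{x ∈ K} sup_{θ, a, b} ‖κ(θ, a, b) - x‖`. -/
def vmax : ℝ :=
  sSup {r : ℝ | ∃ x ∈ G.K, ∃ θ a b, r = ‖G.κ θ a b - x‖}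

end Game

/-- The harmonic rescaled times `t(n) = ∑_{i=1}^n 1/i`. -/
def rescaledTime (n : ℕ) : ℝ := ∑ i ∈ Finset.Icc 1 n, 1 / (i : ℝ)

/-- The running averages `x_{n+1} = x_n + (r_n - x_n)/(n+1)` started at `x₀`. -/
def average {d : ℕ} (x₀ : Vec d) (r : ℕ → Vec d) : ℕ → Vec d
  | 0 => x₀
  | n + 1 => average x₀ r n + (1 / ((n : ℝ) + 1)) • (r n - average x₀ r n)

/-- The linear interpolation `x̄(t)`, `t ≥ 0`, of a sequence `(x_n)`, with `x̄(t(n)) = x_n`: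
here `n` is the index with `t ∈ [t(n), t(n+1))`. -/
def interpolate {d : ℕ} (x : ℕ → Vec d) (t : ℝ) : Vec d :=
  let n : ℕ := sInf {n : ℕ | t < rescaledTime (n + 1)}
  ((rescaledTime (n + 1) - t) / (rescaledTime (n + 1) - rescaledTime n)) • x n +
    ((t - rescaledTime n) / (rescaledTime (n + 1) - rescaledTime n)) • x (n + 1)

/-- The choices that the player makes to set up the scheme. Functions on `K \ D̄` or on the
countable set of centres are total functions, constrained only there. -/
structure Scheme {S Up Ua : Type*} [Fintype S] [Fintype Up] [Fintype Ua] {d : ℕ}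
    (G : Game S Up Ua d) where
  /-- the strategy `π^p_x` for `x ∈ K \ D̄` -/
  strat : Vec d → Strategy S Up
  /-- the arbitrary strategy `π^p_0` used from points of `D̄` -/
  strat₀ : Strategy S Up
  /-- the radii `ρ(x)` -/
  ρ : Vec d → ℝ
  ρ_pos : ∀ x ∈ G.K \ closure G.D, 0 < ρ x
  /-- `inf_{y ∈ B(x, ρ(x))} inf_{πa} ⟪κ̄(π^p_x, πa) - y_{D̄}, y_{D̄} - y⟫ > 0` -/
  separates : ∀ x ∈ G.K \ closure G.D, ∃ ε > 0, ∀ y ∈ Metric.ball x (ρ x),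
    ∀ πa : Strategy S Ua,
      ε ≤ inner ℝ (G.meanReward (strat x) πa - G.proj y) (G.proj y - y)
  /-- the finite sets `𝒬_n` -/
  net : ℕ → Finset (Vec d)
  net_subset : ∀ n, (net n : Set (Vec d)) ⊆ G.layer n
  net_covers : ∀ n, G.layer n ⊆ ⋃ q ∈ net n, Metric.ball q (ρ q / 2)
  /-- the enumeration `I` of `𝒬 = ⋃ 𝒬_n` -/
  index : Vec d → ℕ
  index_injOn : Set.InjOn index (⋃ n, (net n : Set (Vec d)))
  /-- the rescaled holding durations `T(q)` -/
  T : Vec d → ℝ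
  T_bounds : ∀ q ∈ ⋃ n, (net n : Set (Vec d)),
    ρ q / (4 * G.vmax) < T q ∧ T q < ρ q / (3 * G.vmax)

namespace Scheme

variable {S Up Ua : Type*} [Fintype S] [Fintype Up] [Fintype Ua] {d : ℕ}
variable {G : Game S Up Ua d} (C : Scheme G)

/-- The countable set `𝒬 = ⋃ 𝒬_n` of centres. -/
def centres : Set (Vec d) := ⋃ n, (C.net n : Set (Vec d))

open Classical in
/-- `Q(x)`: the centre `q` of least index `I(q)` with `x ∈ B(q, ρ(q)/2)`. One exists for every
`x ∈ K \ D̄`; elsewhere the value is not used. -/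
def Q (x : Vec d) : Vec d :=
  if h : {q ∈ C.centres | x ∈ Metric.ball q (C.ρ q / 2)}.Nonempty
  then Function.argminOn C.index {q ∈ C.centres | x ∈ Metric.ball q (C.ρ q / 2)} h
  else x

open Classical in
/-- The switching time that follows a switching time `s`: if `x_s ∈ D̄` it is `s + 1`, and
otherwise the least `m` with `∑_{i=s}^{m-1} 1/i > T(Q(x_s))`; for `s = 0` the undefined
term `1/0` is left out of the sum. -/
def nextSwitch (x : ℕ → Vec d) (s : ℕ) : ℕ :=
  if x s ∈ closure G.D then s + 1
  else sInf {m : ℕ | C.T (C.Q (x s)) < ∑ i ∈ Finset.Ico (max s 1) m, 1 / (i : ℝ)}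

/-- The switching times `s_0 = 0 < s_1 < s_2 < …` along the sequence `(x_n)`. -/
def switchTime (x : ℕ → Vec d) : ℕ → ℕ
  | 0 => 0
  | n + 1 => C.nextSwitch x (switchTime x n)

/-- The number `k` of the holding period that contains time `n`: `s_k ≤ n < s_{k+1}`
(`k ≤ n`, since the switching times are strictly increasing). -/
def period (x : ℕ → Vec d) (n : ℕ) : ℕ :=
  Nat.findGreatest (fun k => C.switchTime x k ≤ n) n

open Classical in
/-- The strategy that the scheme prescribes at time `n`: chosen at the last switching time `s ≤ n`,
it is `π^p_q` with `q = Q(x_s)` if `x_s ∉ D̄`, and `π^p_0` if `x_s ∈ D̄`. -/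
def playerStrategy (x : ℕ → Vec d) (n : ℕ) : Strategy S Up :=
  let s := C.switchTime x (C.period x n)
  if x s ∈ closure G.D then C.strat₀ else C.strat (C.Q (x s))

/-- The trajectory `ȳ_m` on `[0, ∞)`: `x̄` shifted to start at time `t(s_m)` and frozen from
the time `t(s_{m+1})` on. -/
def trajectory (x : ℕ → Vec d) (m : ℕ) (t : ℝ) : Vec d :=
  if t ≤ rescaledTime (C.switchTime x (m + 1)) - rescaledTime (C.switchTime x m)
  then interpolate x (rescaledTime (C.switchTime x m) + t)
  else interpolate x (rescaledTime (C.switchTime x (m + 1)))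

/-- The vector `κ_{j,k}` of a trajectory `y` on `[0, T]`:
`(y(2^{-k}(j+1)T) - e^{-2^{-k}T} y(2^{-k}jT)) / (1 - e^{-2^{-k}T})`. -/
def dyadicReward (y : ℝ → Vec d) (T : ℝ) (j k : ℕ) : Vec d :=
  let h : ℝ := T / 2 ^ k
  (1 - Real.exp (-h))⁻¹ • (y (((j : ℝ) + 1) * h) - Real.exp (-h) • y ((j : ℝ) * h))

/-- `N(q, j, k)`: the sequences `(x_n)` with a subsequence `(s_{m(n)})` of switching times such that
`x_{s_{m(n)}} ∈ K \ D̄` and `Q(x_{s_{m(n)}}) = q` for all `n`, and whose trajectories `ȳ_{m(n)}`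
converge, uniformly on compacts of `[0, ∞)`, to a limit `y` with `κ_{j,k} ∉ closure R(π^p_q)`. -/
def exceptionalAt (q : Vec d) (j k : ℕ) : Set (ℕ → Vec d) :=
  {x | ∃ m : ℕ → ℕ, StrictMono m ∧
    (∀ n, x (C.switchTime x (m n)) ∈ G.K \ closure G.D ∧ C.Q (x (C.switchTime x (m n))) = q) ∧
    ∃ y : ℝ → Vec d,
      (∀ b : ℝ, TendstoUniformlyOn (fun n => C.trajectory x (m n)) y atTop (Set.Icc 0 b)) ∧
      dyadicReward y (C.T q) j k ∉ closure (G.rewardSet (C.strat q))}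

/-- The exceptional set `N = ⋃_q ⋃_k ⋃_{j < 2^k} N(q, j, k)`. -/
def exceptional : Set (ℕ → Vec d) :=
  ⋃ q ∈ C.centres, ⋃ k : ℕ, ⋃ j ∈ Finset.range (2 ^ k), C.exceptionalAt q j k

/-- The running averages `(x_n)` of the realized rewards, with initial value `x₀`, in the
outcome `ω`. -/
def path (_C : Scheme G) {Ω : Type*} (x₀ : Vec d) (θ : ℕ → Ω → S) (up : ℕ → Ω → Up)
    (ua : ℕ → Ω → Ua) (ω : Ω) : ℕ → Vec d :=
  average x₀ fun n => G.κ (θ n ω) (up n ω) (ua n ω)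

/-- `(θ_n, u^p_n, u^a_n)` is a play of the controlled chain in which the player follows the
scheme. The σ-algebra `ℱ n` is the past available at time `n`: it determines the states up to time
`n` and the actions before time `n`, and possibly private randomness. The adversary picks any
strategy `πa n` depending on the past; given the past, the two actions are drawn independently from
the current strategies, and the next state from the kernel. -/
structure IsPlay {Ω : Type*} [mΩ : MeasurableSpace Ω] (μ : Measure Ω) (ℱ : Filtration ℕ mΩ)
    (x₀ : Vec d) (θ : ℕ → Ω → S) (up : ℕ → Ω → Up) (ua : ℕ → Ω → Ua)
    (πa : ℕ → Ω → Strategy S Ua) : Prop where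
  state_meas : ∀ n s, MeasurableSet[ℱ n] {ω | θ n ω = s}
  player_meas : ∀ n a, MeasurableSet[ℱ (n + 1)] {ω | up n ω = a}
  adversary_meas : ∀ n b, MeasurableSet[ℱ (n + 1)] {ω | ua n ω = b}
  strategy_meas : ∀ n s b, Measurable[ℱ n] fun ω => πa n ω s b
  step : ∀ n a b s,
    μ[Set.indicator {ω | up n ω = a ∧ ua n ω = b ∧ θ (n + 1) ω = s} (fun _ => (1 : ℝ)) | ℱ n]
      =ᵐ[μ] fun ω =>
        C.playerStrategy (C.path x₀ θ up ua ω) n (θ n ω) a * πa n ω (θ n ω) b *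
          G.p (θ n ω) a b s

end Scheme

end Approach

end

/-!
The averages satisfy `N x_N - M x_M = κ_M + ⋯ + κ_{N-1}`, and `M / N → e^{-h}` along times with
`t(N) - t(M) → h`. Hence the vector `κ_{j,k}` of a limit trajectory is the limit of the uniform
averages of the rewards over windows `[M, N)` that lie in holding periods of `q`. By the strong law
for martingale differences, the frequencies of the transitions `(θ, a, b, θ')` in these windows
have almost surely the same limits as their averaged conditional probabilities. Every limit of them
is therefore a stationary law in which the player draws from `π^p_q`; conditioning it on the state
gives an adversary strategy with mean reward `κ_{j,k}`, so that `κ_{j,k} ∈ R(π^p_q)`.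

Off the exceptional set, a limit trajectory moves on `[0, T(q)]` towards points of
`closure R(π^p_q)`. The trajectory stays in the ball `B(q, ρ(q))`, where these points are separated
from its current position by the nearest point of `D̄`; hence `dist(·, D)²` drops by a definite
amount. Away from `D` only finitely many centres occur, so the drop is uniform along the switching
times and `dist(x_{s_m}, D)` tends to `0`. As `ρ(q) ≤ dist(q, D)`, the average cannot move far in
one holding period relative to its distance from `D`, and the whole sequence follows.
-/

noncomputable section

namespace Approach

section MartingaleDifferences

theorem tendsto_inv_smul_sum_of_tendsto_sum_inv_smul {E : Type*} [NormedAddCommGroup E]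
    [NormedSpace ℝ E] {v : ℕ → E} {c : E}
    (h : Tendsto (fun n => ∑ i ∈ Finset.range n, ((i : ℝ) + 1)⁻¹ • v i) atTop (𝓝 c)) :
    Tendsto (fun n : ℕ => (n : ℝ)⁻¹ • ∑ i ∈ Finset.range n, v i) atTop (𝓝 0) := by
  set Z : ℕ → E := fun n => ∑ i ∈ Finset.range n, ((i : ℝ) + 1)⁻¹ • v i with hZ
  have sum_eq_sub (n : ℕ) :
      ∑ i ∈ Finset.range n, v i = (n : ℝ) • Z n - ∑ i ∈ Finset.range n, Z i := by
    induction n with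
    | zero => simp
    | succ n ih =>
      have hn : (n : ℝ) + 1 ≠ 0 := by positivity
      have hZn : ((n : ℝ) + 1) • Z (n + 1) = ((n : ℝ) + 1) • Z n + v n := by
        simp only [hZ, Finset.sum_range_succ, smul_add, smul_inv_smul₀ hn]
      rw [Finset.sum_range_succ, Finset.sum_range_succ, ih, Nat.cast_succ, hZn, add_smul, one_smul]
      abel
  have hlim := h.sub h.cesaro_smul
  rw [sub_self] at hlim
  refine hlim.congr' ?_
  filter_upwards [eventually_ne_atTop 0] with n hn
  rw [sum_eq_sub, smul_sub, inv_smul_smul₀ (Nat.cast_ne_zero.2 hn)]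

variable {Ω : Type*} {mΩ : MeasurableSpace Ω} {μ : Measure Ω} [IsFiniteMeasure μ]

theorem integral_mul_eq_zero_of_condExp_eq_zero {m : MeasurableSpace Ω} (hm : m ≤ mΩ)
    {f g : Ω → ℝ} (hf : StronglyMeasurable[m] f) (hg : Integrable g μ)
    (hfg : Integrable (f * g) μ) (hg₀ : μ[g | m] =ᵐ[μ] 0) : ∫ ω, (f * g) ω ∂μ = 0 := by
  rw [← integral_condExp hm]
  refine integral_eq_zero_of_ae ?_
  filter_upwards [condExp_mul_of_stronglyMeasurable_left hf hfg hg, hg₀] with ω hmul hzero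
  simp [hmul, hzero]

variable {ℱ : Filtration ℕ mΩ} {D : ℕ → Ω → ℝ}

theorem stronglyMeasurable_sum_range (hD : ∀ n, StronglyMeasurable[ℱ (n + 1)] (D n)) (n : ℕ) :
    StronglyMeasurable[ℱ n] (∑ i ∈ Finset.range n, D i) :=
  Finset.stronglyMeasurable_sum _ fun i hi => (hD i).mono (ℱ.mono (Finset.mem_range.1 hi))

theorem integral_sq_sum_range_eq (hD : ∀ n, StronglyMeasurable[ℱ (n + 1)] (D n))
    (hL2 : ∀ n, MemLp (D n) 2 μ) (hD₀ : ∀ n, μ[D n | ℱ n] =ᵐ[μ] 0) (n : ℕ) :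
    ∫ ω, (∑ i ∈ Finset.range n, D i) ω ^ 2 ∂μ = ∑ i ∈ Finset.range n, ∫ ω, D i ω ^ 2 ∂μ := by
  induction n with
  | zero => simp
  | succ n ih =>
    set Z : Ω → ℝ := ∑ i ∈ Finset.range n, D i
    have hZ : MemLp Z 2 μ := memLp_finsetSum' _ fun i _ => hL2 i
    have hZD : Integrable (Z * D n) μ := hZ.integrable_mul (hL2 n)
    have orthogonal : ∫ ω, (Z * D n) ω ∂μ = 0 :=
      integral_mul_eq_zero_of_condExp_eq_zero (ℱ.le n) (stronglyMeasurable_sum_range hD n)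
        ((hL2 n).integrable one_le_two) hZD (hD₀ n)
    calc ∫ ω, (∑ i ∈ Finset.range (n + 1), D i) ω ^ 2 ∂μ
        = ∫ ω, (Z ω ^ 2 + 2 * (Z * D n) ω) + D n ω ^ 2 ∂μ := by
          refine integral_congr_ae (Eventually.of_forall fun ω => ?_)
          simp only [Finset.sum_range_succ, Pi.add_apply, Pi.mul_apply, Z]
          ring
      _ = ∫ ω, Z ω ^ 2 ∂μ + ∫ ω, D n ω ^ 2 ∂μ := by
          have hint : Integrable (fun ω => Z ω ^ 2 + 2 * (Z * D n) ω) μ :=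
            hZ.integrable_sq.add (hZD.const_mul 2)
          rw [integral_add hint (hL2 n).integrable_sq,
            integral_add hZ.integrable_sq (hZD.const_mul 2), integral_const_mul, orthogonal,
            mul_zero, add_zero]
      _ = _ := by rw [ih, Finset.sum_range_succ]

theorem ae_exists_tendsto_sum_of_summable_integral_sq
    (hD : ∀ n, StronglyMeasurable[ℱ (n + 1)] (D n)) (hL2 : ∀ n, MemLp (D n) 2 μ)
    (hD₀ : ∀ n, μ[D n | ℱ n] =ᵐ[μ] 0) (hsum : Summable fun n => ∫ ω, D n ω ^ 2 ∂μ) :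
    ∀ᵐ ω ∂μ, ∃ c, Tendsto (fun n => ∑ i ∈ Finset.range n, D i ω) atTop (𝓝 c) := by
  set Z : ℕ → Ω → ℝ := fun n => ∑ i ∈ Finset.range n, D i with hZdef
  have hZ (n : ℕ) : MemLp (Z n) 2 μ := memLp_finsetSum' _ fun i _ => hL2 i
  have hmart : Martingale Z ℱ μ :=
    martingale_of_condExp_sub_eq_zero_nat (stronglyMeasurable_sum_range hD)
      (fun n => (hZ n).integrable one_le_two) fun n => by
        simpa only [hZdef, Finset.sum_range_succ, add_sub_cancel_left] using hD₀ n
  have hbdd (n : ℕ) : eLpNorm (Z n) 1 μ ≤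
      (Real.toNNReal (μ.real Set.univ + ∑' i, ∫ ω, D i ω ^ 2 ∂μ) : NNReal) := by
    have hZint := (hZ n).integrable one_le_two
    rw [eLpNorm_one_eq_lintegral_enorm, ← ofReal_integral_norm_eq_lintegral_enorm hZint]
    refine ENNReal.ofReal_le_ofReal ?_
    calc ∫ ω, ‖Z n ω‖ ∂μ ≤ ∫ ω, (1 + Z n ω ^ 2) ∂μ := by
          refine integral_mono hZint.norm ((integrable_const _).add (hZ n).integrable_sq)
            fun ω => ?_
          simp only [Real.norm_eq_abs]
          nlinarith [sq_abs (Z n ω), sq_nonneg (|Z n ω| - 1)]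
      _ = μ.real Set.univ + ∑ i ∈ Finset.range n, ∫ ω, D i ω ^ 2 ∂μ := by
          rw [integral_add (integrable_const _) (hZ n).integrable_sq,
            integral_sq_sum_range_eq hD hL2 hD₀, integral_const, smul_eq_mul, mul_one]
      _ ≤ _ := by
          gcongr
          exact hsum.sum_le_tsum _ fun i _ => integral_nonneg fun ω => sq_nonneg _
  filter_upwards [hmart.submartingale.exists_ae_tendsto_of_bdd hbdd] with ω ⟨c, hc⟩
  exact ⟨c, by simpa only [hZdef, Finset.sum_apply] using hc⟩

theorem ae_tendsto_inv_mul_sum_of_condExp_eq_zero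
    (hD : ∀ n, StronglyMeasurable[ℱ (n + 1)] (D n)) (hL2 : ∀ n, MemLp (D n) 2 μ)
    (hD₀ : ∀ n, μ[D n | ℱ n] =ᵐ[μ] 0)
    (hsum : Summable fun n : ℕ => (((n : ℝ) + 1)⁻¹) ^ 2 * ∫ ω, D n ω ^ 2 ∂μ) :
    ∀ᵐ ω ∂μ, Tendsto (fun n : ℕ => (n : ℝ)⁻¹ * ∑ i ∈ Finset.range n, D i ω) atTop (𝓝 0) := by
  have hconv := ae_exists_tendsto_sum_of_summable_integral_sq (μ := μ) (ℱ := ℱ)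
    (D := fun n => ((n : ℝ) + 1)⁻¹ • D n) (fun n => (hD n).const_smul _)
    (fun n => (hL2 n).const_smul _)
    (fun n => (condExp_smul _ _ _).trans <| by
      filter_upwards [hD₀ n] with ω hω
      simp [hω])
    (by simpa only [Pi.smul_apply, smul_eq_mul, mul_pow, integral_const_mul] using hsum)
  filter_upwards [hconv] with ω ⟨c, hc⟩
  exact tendsto_inv_smul_sum_of_tendsto_sum_inv_smul hc

theorem ae_tendsto_inv_mul_sum_of_ae_abs_le
    (hD : ∀ n, StronglyMeasurable[ℱ (n + 1)] (D n)) {C : ℝ}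
    (hC : ∀ n, ∀ᵐ ω ∂μ, |D n ω| ≤ C) (hD₀ : ∀ n, μ[D n | ℱ n] =ᵐ[μ] 0) :
    ∀ᵐ ω ∂μ, Tendsto (fun n : ℕ => (n : ℝ)⁻¹ * ∑ i ∈ Finset.range n, D i ω) atTop (𝓝 0) := by
  have hL2 (n : ℕ) : MemLp (D n) 2 μ :=
    MemLp.of_bound ((hD n).mono (ℱ.le _)).aestronglyMeasurable C (hC n)
  have integral_sq_le (n : ℕ) : ∫ ω, D n ω ^ 2 ∂μ ≤ μ.real Set.univ * C ^ 2 := by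
    calc ∫ ω, D n ω ^ 2 ∂μ ≤ ∫ _, C ^ 2 ∂μ := by
          refine integral_mono_ae (hL2 n).integrable_sq (integrable_const _) ?_
          filter_upwards [hC n] with ω hω
          exact sq_le_sq' (neg_le_of_abs_le hω) (le_of_abs_le hω)
      _ = _ := by rw [integral_const, smul_eq_mul]
  have summable_inv_sq : Summable fun n : ℕ => (((n : ℝ) + 1)⁻¹) ^ 2 := by
    simpa using (summable_nat_add_iff 1).2 (Real.summable_nat_pow_inv.2 one_lt_two)
  refine ae_tendsto_inv_mul_sum_of_condExp_eq_zero hD hL2 hD₀ <|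
    (summable_inv_sq.mul_right (μ.real Set.univ * C ^ 2)).of_nonneg_of_le
      (fun n => mul_nonneg (sq_nonneg _) (integral_nonneg fun ω => sq_nonneg _)) fun n => ?_
  gcongr
  exact integral_sq_le n

theorem ae_tendsto_inv_mul_sum_indicator_sub {A : ℕ → Set Ω}
    (hA : ∀ n, MeasurableSet[ℱ (n + 1)] (A n)) {f : ℕ → Ω → ℝ}
    (hf : ∀ n, μ[(A n).indicator (fun _ => (1 : ℝ)) | ℱ n] =ᵐ[μ] f n) :
    ∀ᵐ ω ∂μ, Tendsto (fun n : ℕ => (n : ℝ)⁻¹ *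
      ∑ i ∈ Finset.range n, ((A i).indicator (fun _ => (1 : ℝ)) ω - f i ω)) atTop (𝓝 0) := by
  let χ : ℕ → Ω → ℝ := fun n => (A n).indicator fun _ => 1
  have hχ (n : ℕ) : StronglyMeasurable[ℱ (n + 1)] (χ n) :=
    stronglyMeasurable_const.indicator (hA n)
  have hχ_le (n : ℕ) (ω : Ω) : |χ n ω| ≤ 1 := by
    by_cases hω : ω ∈ A n <;> simp [χ, hω]
  have hχ_int (n : ℕ) : Integrable (χ n) μ :=
    Integrable.of_bound ((hχ n).mono (ℱ.le _)).aestronglyMeasurable 1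
      (Eventually.of_forall (hχ_le n))
  have hconv := ae_tendsto_inv_mul_sum_of_ae_abs_le (μ := μ) (ℱ := ℱ)
    (D := fun n => χ n - μ[χ n | ℱ n]) (C := 2)
    (fun n => (hχ n).sub (stronglyMeasurable_condExp.mono (ℱ.mono n.le_succ)))
    (fun n => by
      filter_upwards [ae_bdd_abs_condExp_of_ae_bdd_abs (m := ℱ n) (R := (1 : ℝ))
        (Eventually.of_forall (hχ_le n))] with ω hω
      exact (abs_sub _ _).trans (by linarith [hχ_le n ω, hω]))
    (fun n => by
      filter_upwards [condExp_sub (hχ_int n) integrable_condExp (ℱ n),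
        condExp_condExp_of_le (f := χ n) (μ := μ) le_rfl (ℱ.le n)] with ω hsub hidem
      rw [hsub, Pi.sub_apply, hidem, sub_self, Pi.zero_apply])
  filter_upwards [hconv, ae_all_iff.2 hf] with ω hω hfω
  simpa only [χ, Pi.sub_apply, hfω] using hω

end MartingaleDifferences

section StationaryDistributions

open Matrix

variable {S : Type*} [Fintype S] {P : Matrix S S ℝ}

theorem vecMul_pow_eq_self [DecidableEq S] {f : S → ℝ} (hf : f ᵥ* P = f) (k : ℕ) :
    f ᵥ* P ^ k = f := by
  induction k with
  | zero => rw [pow_zero, vecMul_one]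
  | succ k ih => rw [pow_succ, ← vecMul_vecMul, ih, hf]

theorem pos_of_vecMul_eq_self (hP : P.IsIrreducible) {f : S → ℝ} (hf₀ : 0 ≤ f) (hf : f ᵥ* P = f)
    (hne : f ≠ 0) (j : S) : 0 < f j := by
  classical
  obtain ⟨i, hi⟩ := Function.ne_iff.1 hne
  obtain ⟨k, -, hk⟩ := (isIrreducible_iff_exists_pow_pos hP.nonneg).1 hP i j
  calc 0 < f i * (P ^ k) i j := mul_pos (lt_of_le_of_ne (hf₀ i) hi.symm) hk
    _ ≤ (f ᵥ* P ^ k) j := Finset.single_le_sum (f := fun l => f l * (P ^ k) l j)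
        (fun l _ => mul_nonneg (hf₀ l) (pow_apply_nonneg hP.nonneg k l j)) (Finset.mem_univ i)
    _ = f j := by rw [vecMul_pow_eq_self hf]

variable [DecidableEq S]

theorem sum_vecMul_of_mem_rowStochastic (hP : P ∈ rowStochastic ℝ S) (f : S → ℝ) :
    ∑ j, (f ᵥ* P) j = ∑ j, f j := by
  simp only [vecMul, dotProduct]
  rw [Finset.sum_comm]
  exact Finset.sum_congr rfl fun i _ => by
    rw [← Finset.mul_sum, sum_row_of_mem_rowStochastic hP, mul_one]

/-- `g⁺ ≤ g⁺P` entrywise, and both vectors have the same mass. -/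
theorem posPart_vecMul_eq_self (hP : P ∈ rowStochastic ℝ S) {g : S → ℝ} (hg : g ᵥ* P = g) :
    g⁺ ᵥ* P = g⁺ := by
  have hle (j : S) : g⁺ j ≤ (g⁺ ᵥ* P) j := by
    refine sup_le ?_ (nonneg_vecMul_of_mem_rowStochastic hP (posPart_nonneg g) j)
    conv_lhs => rw [← hg]
    exact Finset.sum_le_sum fun i _ =>
      mul_le_mul_of_nonneg_right (le_posPart g i) (nonneg_of_mem_rowStochastic hP)
  funext j
  exact ((Finset.sum_eq_sum_iff_of_le fun j _ => hle j).1
    (sum_vecMul_of_mem_rowStochastic hP g⁺).symm j (Finset.mem_univ j)).symm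

theorem exists_ne_zero_vecMul_eq_self [Nonempty S] (hP : P ∈ rowStochastic ℝ S) :
    ∃ g : S → ℝ, g ≠ 0 ∧ g ᵥ* P = g := by
  have hdet : (P - 1).det = 0 := exists_mulVec_eq_zero_iff.1
    ⟨1, one_ne_zero, by rw [sub_mulVec, (mem_rowStochastic.1 hP).2, one_mulVec, sub_self]⟩
  obtain ⟨g, hg, hgP⟩ := exists_vecMul_eq_zero_iff.2 hdet
  exact ⟨g, hg, by rwa [vecMul_sub, vecMul_one, sub_eq_zero] at hgP⟩

theorem exists_nonneg_vecMul_eq_self [Nonempty S] (hP : P ∈ rowStochastic ℝ S) :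
    ∃ f : S → ℝ, 0 ≤ f ∧ f ≠ 0 ∧ f ᵥ* P = f := by
  obtain ⟨g, hg, hgP⟩ := exists_ne_zero_vecMul_eq_self hP
  by_cases h : g⁺ = 0
  · refine ⟨-g, neg_nonneg.2 (posPart_eq_zero.1 h), neg_ne_zero.2 hg, ?_⟩
    rw [neg_vecMul, hgP]
  · exact ⟨g⁺, posPart_nonneg g, h, posPart_vecMul_eq_self hP hgP⟩

namespace Game

theorem exists_isStationary [Nonempty S] (hP : P ∈ rowStochastic ℝ S) :
    ∃ η, IsStationary P η := by
  obtain ⟨f, hf₀, hf, hfP⟩ := exists_nonneg_vecMul_eq_self hP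
  have hmass : 0 < ∑ i, f i := Fintype.sum_pos (lt_of_le_of_ne hf₀ hf.symm)
  refine ⟨(∑ i, f i)⁻¹ • f, ⟨fun i => mul_nonneg (inv_nonneg.2 hmass.le) (hf₀ i), ?_⟩, ?_⟩
  · simp only [Pi.smul_apply, smul_eq_mul, ← Finset.mul_sum, inv_mul_cancel₀ hmass.ne']
  · rw [smul_vecMul, hfP]

theorem IsStationary.le_of_isIrreducible (hP : P ∈ rowStochastic ℝ S) (hirr : P.IsIrreducible)
    {η η' : S → ℝ} (h : IsStationary P η) (h' : IsStationary P η') : η ≤ η' := by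
  by_contra hle
  have hinv : (η - η')⁺ ᵥ* P = (η - η')⁺ :=
    posPart_vecMul_eq_self hP (by rw [sub_vecMul, h.2, h'.2])
  have hpos (j : S) : η' j < η j := by
    have := pos_of_vecMul_eq_self hirr (posPart_nonneg _) hinv
      (fun h0 => hle (sub_nonpos.1 (posPart_eq_zero.1 h0))) j
    exact sub_pos.1 (posPart_pos_iff.1 this)
  have : Nonempty S := not_isEmpty_iff.1 fun _ => hle fun i => isEmptyElim i
  exact (Finset.sum_lt_sum_of_nonempty Finset.univ_nonempty fun j _ => hpos j).ne
    (h'.1.2.trans h.1.2.symm)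

theorem IsStationary.eq_of_isIrreducible (hP : P ∈ rowStochastic ℝ S) (hirr : P.IsIrreducible)
    {η η' : S → ℝ} (h : IsStationary P η) (h' : IsStationary P η') : η = η' :=
  (h.le_of_isIrreducible hP hirr h').antisymm (h'.le_of_isIrreducible hP hirr h)

variable {Up Ua : Type*} [Fintype Up] [Fintype Ua] {d : ℕ} (G : Game S Up Ua d)

theorem transition_mem_rowStochastic (πp : Strategy S Up) (πa : Strategy S Ua) :
    G.transition πp πa ∈ rowStochastic ℝ S := by
  refine mem_rowStochastic_iff_sum.2 ⟨fun θ θ' => Finset.sum_nonneg fun a _ =>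
    Finset.sum_nonneg fun b _ => mul_nonneg (mul_nonneg ((πp θ).2.1 a) ((πa θ).2.1 b))
      ((G.p θ a b).2.1 θ'), fun θ => ?_⟩
  calc ∑ θ', ∑ a, ∑ b, πp θ a * πa θ b * G.p θ a b θ'
      = ∑ a, ∑ b, ∑ θ', πp θ a * πa θ b * G.p θ a b θ' := by
        rw [Finset.sum_comm]
        exact Finset.sum_congr rfl fun a _ => Finset.sum_comm
    _ = ∑ a, ∑ b, πp θ a * πa θ b := by
        simp only [← Finset.mul_sum, stdSimplex.sum_eq_one, mul_one]
    _ = 1 := by simp only [← Finset.mul_sum, stdSimplex.sum_eq_one, mul_one]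

end Game

end StationaryDistributions

namespace Game

variable {S Up Ua : Type*} [Fintype S] [Fintype Up] [Fintype Ua] {d : ℕ} {G : Game S Up Ua d}

theorem isStationary_stationary [Nonempty S] (πp : Strategy S Up) (πa : Strategy S Ua) :
    IsStationary (G.transition πp πa) (G.stationary πp πa) := by
  classical
  have h := exists_isStationary (G.transition_mem_rowStochastic πp πa)
  rw [stationary, dif_pos h]
  exact h.choose_spec

theorem Ergodic.stationary_eq (hG : G.Ergodic) {πp : Strategy S Up} {πa : Strategy S Ua}
    {η : S → ℝ} (hη : IsStationary (G.transition πp πa) η) : G.stationary πp πa = η := by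
  classical
  have h : ∃ η, IsStationary (G.transition πp πa) η := ⟨η, hη⟩
  rw [stationary, dif_pos h]
  exact h.choose_spec.eq_of_isIrreducible (G.transition_mem_rowStochastic πp πa) (hG πp πa) hη

theorem meanReward_mem_convexHull [Nonempty S] (πp : Strategy S Up) (πa : Strategy S Ua) :
    G.meanReward πp πa ∈ convexHull ℝ {r | ∃ θ a b, r = G.κ θ a b} := by
  have hη := (isStationary_stationary (G := G) πp πa).1
  have hsum : G.meanReward πp πa = ∑ z : S × Up × Ua,
      (G.stationary πp πa z.1 * πp z.1 z.2.1 * πa z.1 z.2.2) • G.κ z.1 z.2.1 z.2.2 := by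
    simp only [meanReward, Fintype.sum_prod_type]
  rw [hsum]
  refine (convex_convexHull ℝ _).sum_mem (fun z _ => mul_nonneg (mul_nonneg (hη.1 _)
    ((πp z.1).2.1 _)) ((πa z.1).2.1 _)) ?_ fun z _ => subset_convexHull ℝ _ ⟨_, _, _, rfl⟩
  simp only [Fintype.sum_prod_type, ← Finset.mul_sum, stdSimplex.sum_eq_one, mul_one]
  exact hη.2

omit [Fintype Up] [Fintype Ua] in
variable (G) in
theorem finite_setOf_reward [Finite Up] [Finite Ua] : {r | ∃ θ a b, r = G.κ θ a b}.Finite :=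
  (Set.finite_range fun z : S × Up × Ua => G.κ z.1 z.2.1 z.2.2).subset <| by
    rintro _ ⟨θ, a, b, rfl⟩
    exact ⟨(θ, a, b), rfl⟩

theorem isBounded_rewardSet [Nonempty S] (πp : Strategy S Up) :
    Bornology.IsBounded (G.rewardSet πp) := by
  refine (isBounded_convexHull.2 (finite_setOf_reward G).isBounded).subset ?_
  rintro _ ⟨πa, rfl⟩
  exact meanReward_mem_convexHull πp πa

end Game


section EmpiricalFrequencies

variable {Z : Type*}

/-- The empirical frequencies of the values of the sequence `z` over the time window `[M, N)`. -/
def windowFreq (z : ℕ → Z) (M N : ℕ) (w : Z) : ℝ :=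
  ((N : ℝ) - M)⁻¹ * ∑ i ∈ Finset.Ico M N, ({w} : Set Z).indicator 1 (z i)

variable [Fintype Z]

theorem sum_windowFreq_smul {E : Type*} [AddCommGroup E] [Module ℝ E] (z : ℕ → Z) (M N : ℕ)
    (f : Z → E) :
    ∑ w, windowFreq z M N w • f w = ((N : ℝ) - M)⁻¹ • ∑ i ∈ Finset.Ico M N, f (z i) := by
  classical
  simp only [windowFreq, mul_smul, Finset.sum_smul]
  rw [← Finset.smul_sum, Finset.sum_comm]
  refine congrArg _ (Finset.sum_congr rfl fun i _ => ?_)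
  simp [Set.indicator_apply]

theorem windowFreq_mem_stdSimplex (z : ℕ → Z) {M N : ℕ} (h : M < N) :
    windowFreq z M N ∈ stdSimplex ℝ Z := by
  have hpos : (0 : ℝ) < N - M := sub_pos.2 (Nat.cast_lt.2 h)
  refine ⟨fun w => mul_nonneg (inv_nonneg.2 hpos.le) (Finset.sum_nonneg fun i _ =>
    Set.indicator_nonneg (fun _ _ => zero_le_one) _), ?_⟩
  simpa [Nat.cast_sub h.le, hpos.ne'] using sum_windowFreq_smul z M N fun _ => (1 : ℝ)

theorem exists_tendsto_windowFreq (z : ℕ → Z) {M N : ℕ → ℕ} (h : ∀ᶠ n in atTop, M n < N n) :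
    ∃ μ ∈ stdSimplex ℝ Z, ∃ φ : ℕ → ℕ, StrictMono φ ∧
      Tendsto (fun n => windowFreq z (M (φ n)) (N (φ n))) atTop (𝓝 μ) :=
  (isCompact_stdSimplex ℝ Z).tendsto_subseq'
    (h.mono fun _ hn => windowFreq_mem_stdSimplex z hn).frequently

theorem tendsto_inv_smul_sum_of_tendsto_windowFreq {z : ℕ → Z} {M N : ℕ → ℕ} {μ : Z → ℝ}
    (h : Tendsto (fun n => windowFreq z (M n) (N n)) atTop (𝓝 μ)) {E : Type*} [AddCommGroup E]
    [Module ℝ E] [TopologicalSpace E] [ContinuousAdd E] [ContinuousSMul ℝ E] (f : Z → E) :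
    Tendsto (fun n => ((N n : ℝ) - M n)⁻¹ • ∑ i ∈ Finset.Ico (M n) (N n), f (z i)) atTop
      (𝓝 (∑ w, μ w • f w)) :=
  (tendsto_finsetSum _ fun w _ => (tendsto_pi_nhds.1 h w).smul_const (f w)).congr
    fun n => sum_windowFreq_smul z (M n) (N n) f

theorem tendsto_inv_mul_sum_Ico_sub {f : ℕ → ℝ} {B : ℝ} (hf : ∀ i, |f i| ≤ B) {M N : ℕ → ℕ}
    (hMN : Tendsto (fun n => (N n : ℝ) - M n) atTop atTop) :
    Tendsto (fun n => ((N n : ℝ) - M n)⁻¹ * ∑ i ∈ Finset.Ico (M n) (N n), (f (i + 1) - f i))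
      atTop (𝓝 0) := by
  refine hMN.inv_tendsto_atTop.zero_mul_isBoundedUnder_le
    (isBoundedUnder_of_eventually_le (a := B + B) ?_)
  filter_upwards [hMN.eventually_ge_atTop 0] with n hn
  rw [Function.comp, Finset.sum_Ico_sub f (Nat.cast_le.1 (sub_nonneg.1 hn))]
  exact (norm_sub_le _ _).trans (add_le_add (hf _) (hf _))

end EmpiricalFrequencies

namespace Game

variable {S Up Ua : Type*} [Fintype S] [Fintype Up] [Fintype Ua] {d : ℕ} {G : Game S Up Ua d}

/-- `μ` is a stationary probability law on transitions `(θ, a, b, θ')` in which the player draws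
`a` from `πp` independently of the adversary's action. -/
structure IsStationaryLaw (G : Game S Up Ua d) (πp : Strategy S Up) (μ : S × Up × Ua × S → ℝ) :
    Prop where
  mem_stdSimplex : μ ∈ stdSimplex ℝ (S × Up × Ua × S)
  disintegration : ∀ s a b s',
    μ (s, a, b, s') = πp s a * G.p s a b s' * ∑ a', ∑ s'', μ (s, a', b, s'')
  balance : ∀ s', ∑ s, ∑ a, ∑ b, μ (s, a, b, s') = ∑ a, ∑ b, ∑ s'', μ (s', a, b, s'')

omit [Fintype S] in
theorem exists_strategy_eq_mul [Nonempty Ua] {ν : S → Ua → ℝ} (hν : ∀ s b, 0 ≤ ν s b) :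
    ∃ πa : Strategy S Ua, ∀ s b, ν s b = (∑ b', ν s b') * πa s b := by
  classical
  suffices ∀ s, ∃ w : stdSimplex ℝ Ua, ∀ b, ν s b = (∑ b', ν s b') * w b from
    Classical.skolem.1 this
  intro s
  by_cases h₀ : ∑ b, ν s b = 0
  · refine ⟨Classical.arbitrary _, fun b => ?_⟩
    rw [h₀, zero_mul]
    exact (Finset.sum_eq_zero_iff_of_nonneg fun b _ => hν s b).1 h₀ b (Finset.mem_univ b)
  · refine ⟨⟨fun b => ν s b / ∑ b', ν s b', fun b =>
      div_nonneg (hν s b) (Finset.sum_nonneg fun b _ => hν s b), ?_⟩, fun b => ?_⟩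
    · rw [← Finset.sum_div, div_self h₀]
    · exact (mul_div_cancel₀ _ h₀).symm

/-- Conditioning the law on the state yields the adversary strategy. -/
theorem IsStationaryLaw.sum_smul_mem_rewardSet [Nonempty Ua] (hG : G.Ergodic)
    {πp : Strategy S Up} {μ : S × Up × Ua × S → ℝ} (hμ : G.IsStationaryLaw πp μ) :
    ∑ w, μ w • G.κ w.1 w.2.1 w.2.2.1 ∈ G.rewardSet πp := by
  let ν : S → Ua → ℝ := fun s b => ∑ a, ∑ s', μ (s, a, b, s')
  obtain ⟨πa, hπa⟩ := exists_strategy_eq_mul (ν := ν) fun s b =>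
    Finset.sum_nonneg fun a _ => Finset.sum_nonneg fun s' _ => hμ.mem_stdSimplex.1 _
  let η : S → ℝ := fun s => ∑ b, ν s b
  have hlaw (s : S) (a : Up) (b : Ua) (s' : S) :
      μ (s, a, b, s') = η s * πp s a * πa s b * G.p s a b s' := by
    rw [hμ.disintegration, show ∑ a', ∑ s'', μ (s, a', b, s'') = η s * πa s b from hπa s b]
    ring
  have hη_eq (s : S) : η s = ∑ a, ∑ b, ∑ s', μ (s, a, b, s') := Finset.sum_comm
  have hη : IsStationary (G.transition πp πa) η := by
    refine ⟨⟨fun s => Finset.sum_nonneg fun b _ => Finset.sum_nonneg fun a _ =>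
      Finset.sum_nonneg fun s' _ => hμ.mem_stdSimplex.1 _, ?_⟩, funext fun s' => ?_⟩
    · simpa only [hη_eq, Fintype.sum_prod_type] using hμ.mem_stdSimplex.2
    · rw [hη_eq s', ← hμ.balance s']
      simp only [Matrix.vecMul, dotProduct, transition, Finset.mul_sum, hlaw, mul_assoc]
  refine ⟨πa, ?_⟩
  simp only [meanReward, hG.stationary_eq hη, Fintype.sum_prod_type, hlaw, ← Finset.sum_smul,
    ← Finset.mul_sum, stdSimplex.sum_eq_one, mul_one]

open Classical in
/-- The conditional law, given the state `s`, of the transition out of `s`. -/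
def transitionProb (G : Game S Up Ua d) (πp : Strategy S Up) (πa : Strategy S Ua) (s : S)
    (w : S × Up × Ua × S) : ℝ :=
  if s = w.1 then πp s w.2.1 * πa s w.2.2.1 * G.p s w.2.1 w.2.2.1 w.2.2.2 else 0

theorem transitionProb_disintegration (πp : Strategy S Up) (πa : Strategy S Ua) (t s : S)
    (a : Up) (b : Ua) (s' : S) :
    G.transitionProb πp πa t (s, a, b, s') =
      πp s a * G.p s a b s' * ∑ a', ∑ s'', G.transitionProb πp πa t (s, a', b, s'') := by
  by_cases h : t = s
  · simp only [transitionProb, h, if_true, ← Finset.mul_sum, stdSimplex.sum_eq_one, mul_one,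
      ← Finset.sum_mul, one_mul]
    ring
  · simp only [transitionProb, h, if_false, Finset.sum_const_zero, mul_zero]

section Windows

variable {πp : Strategy S Up} {θ : ℕ → S} {up : ℕ → Up} {ua : ℕ → Ua} {πa : ℕ → Strategy S Ua}
  {M N : ℕ → ℕ} {μ : S × Up × Ua × S → ℝ}

theorem disintegration_of_tendsto_windowFreq
    (hdev : ∀ w, Tendsto (fun n => ((N n : ℝ) - M n)⁻¹ * ∑ i ∈ Finset.Ico (M n) (N n),
      (({w} : Set _).indicator 1 (θ i, up i, ua i, θ (i + 1)) -
        G.transitionProb πp (πa i) (θ i) w)) atTop (𝓝 0))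
    (hμ : Tendsto (fun n => windowFreq (fun i => (θ i, up i, ua i, θ (i + 1))) (M n) (N n)) atTop
      (𝓝 μ)) (s : S) (a : Up) (b : Ua) (s' : S) :
    μ (s, a, b, s') = πp s a * G.p s a b s' * ∑ a', ∑ s'', μ (s, a', b, s'') := by
  let prob : ℕ → S × Up × Ua × S → ℝ := fun n w =>
    ((N n : ℝ) - M n)⁻¹ * ∑ i ∈ Finset.Ico (M n) (N n), G.transitionProb πp (πa i) (θ i) w
  have hprob (w : S × Up × Ua × S) : Tendsto (fun n => prob n w) atTop (𝓝 (μ w)) := by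
    have h := (tendsto_pi_nhds.1 hμ w).sub (hdev w)
    rw [sub_zero] at h
    refine h.congr fun n => ?_
    simp only [windowFreq, prob, Finset.sum_sub_distrib]
    ring
  refine tendsto_nhds_unique (hprob _) (((tendsto_finsetSum _ fun a' _ =>
    tendsto_finsetSum _ fun s'' _ => hprob (s, a', b, s'')).const_mul
      (πp s a * G.p s a b s')).congr fun n => ?_)
  have sum_swap : ∑ a', ∑ s'', ∑ i ∈ Finset.Ico (M n) (N n),
      G.transitionProb πp (πa i) (θ i) (s, a', b, s'') =
        ∑ i ∈ Finset.Ico (M n) (N n), ∑ a', ∑ s'',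
          G.transitionProb πp (πa i) (θ i) (s, a', b, s'') :=
    (Finset.sum_congr rfl fun _ _ => Finset.sum_comm).trans Finset.sum_comm
  simp only [prob, ← Finset.mul_sum]
  rw [sum_swap, mul_left_comm, Finset.mul_sum]
  exact congrArg _ (Finset.sum_congr rfl fun i _ =>
    (transitionProb_disintegration πp (πa i) (θ i) s a b s').symm)

theorem balance_of_tendsto_windowFreq (hMN : Tendsto (fun n => (N n : ℝ) - M n) atTop atTop)
    (hμ : Tendsto (fun n => windowFreq (fun i => (θ i, up i, ua i, θ (i + 1))) (M n) (N n)) atTop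
      (𝓝 μ)) (s' : S) :
    ∑ s, ∑ a, ∑ b, μ (s, a, b, s') = ∑ a, ∑ b, ∑ s'', μ (s', a, b, s'') := by
  classical
  let χ : S → ℝ := fun s => if s = s' then 1 else 0
  have hlim := tendsto_nhds_unique
    (tendsto_inv_smul_sum_of_tendsto_windowFreq hμ fun w => χ w.2.2.2 - χ w.1)
    (tendsto_inv_mul_sum_Ico_sub (f := fun i => χ (θ i)) (B := 1)
      (fun i => by by_cases h : θ i = s' <;> simp [χ, h]) hMN)
  simp only [smul_eq_mul, Fintype.sum_prod_type, mul_sub, Finset.sum_sub_distrib,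
    ← Finset.sum_mul, sub_eq_zero] at hlim
  simpa [χ] using hlim

theorem mem_rewardSet_of_tendsto_window [Nonempty Ua] (hG : G.Ergodic)
    (hMN : Tendsto (fun n => (N n : ℝ) - M n) atTop atTop)
    (hdev : ∀ w, Tendsto (fun n => ((N n : ℝ) - M n)⁻¹ * ∑ i ∈ Finset.Ico (M n) (N n),
      (({w} : Set _).indicator 1 (θ i, up i, ua i, θ (i + 1)) -
        G.transitionProb πp (πa i) (θ i) w)) atTop (𝓝 0))
    {r : Vec d} (hr : Tendsto (fun n => ((N n : ℝ) - M n)⁻¹ •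
      ∑ i ∈ Finset.Ico (M n) (N n), G.κ (θ i) (up i) (ua i)) atTop (𝓝 r)) :
    r ∈ G.rewardSet πp := by
  have hlt : ∀ᶠ n in atTop, M n < N n := by
    filter_upwards [hMN.eventually_gt_atTop 0] with n hn
    exact Nat.cast_lt.1 (sub_pos.1 hn)
  obtain ⟨μ, hμ, φ, hφ, hlim⟩ :=
    exists_tendsto_windowFreq (fun i => (θ i, up i, ua i, θ (i + 1))) hlt
  have hlaw : G.IsStationaryLaw πp μ :=
    { mem_stdSimplex := hμ
      disintegration := disintegration_of_tendsto_windowFreq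
        (fun w => (hdev w).comp hφ.tendsto_atTop) hlim
      balance := balance_of_tendsto_windowFreq (hMN.comp hφ.tendsto_atTop) hlim }
  have hr_eq : r = ∑ w, μ w • G.κ w.1 w.2.1 w.2.2.1 :=
    tendsto_nhds_unique (hr.comp hφ.tendsto_atTop)
      (tendsto_inv_smul_sum_of_tendsto_windowFreq hlim fun w => G.κ w.1 w.2.1 w.2.2.1)
  exact hr_eq ▸ hlaw.sum_smul_mem_rewardSet hG

end Windows

end Game

section RescaledTime

theorem exists_le_lt_succ {α : Type*} [LinearOrder α] {f : ℕ → α} {a : α} (h₀ : f 0 ≤ a)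
    (h : ∃ n, a < f n) : ∃ n, f n ≤ a ∧ a < f (n + 1) := by
  by_contra! hstep
  obtain ⟨n, hn⟩ := h
  exact hn.not_ge (Nat.rec h₀ (fun k hk => hstep k hk) n)

theorem exists_sInf_lt_sum_Ico_eq_succ {f : ℕ → ℝ} {s : ℕ} {T : ℝ} (hT : 0 ≤ T)
    (h : ∃ m, T < ∑ i ∈ Finset.Ico s m, f i) :
    ∃ m, s ≤ m ∧ sInf {m | T < ∑ i ∈ Finset.Ico s m, f i} = m + 1 ∧
      ∑ i ∈ Finset.Ico s m, f i ≤ T ∧ T < ∑ i ∈ Finset.Ico s (m + 1), f i := by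
  set k := sInf {m | T < ∑ i ∈ Finset.Ico s m, f i}
  have hk : T < ∑ i ∈ Finset.Ico s k, f i := Nat.sInf_mem h
  have hsk : s < k := by
    by_contra! hks
    rw [Finset.Ico_eq_empty_of_le hks, Finset.sum_empty] at hk
    exact hT.not_gt hk
  obtain ⟨m, hm⟩ := Nat.exists_eq_add_one_of_ne_zero (Nat.ne_zero_of_lt hsk)
  refine ⟨m, by omega, hm, not_lt.1 fun hlt => ?_, hm ▸ hk⟩
  exact absurd (Nat.sInf_le hlt : k ≤ m) (by omega)

theorem exists_lt_sum_Ico_one_div (s : ℕ) (T : ℝ) :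
    ∃ m, T < ∑ i ∈ Finset.Ico s m, 1 / (i : ℝ) := by
  have hdiv : Tendsto (fun m => ∑ i ∈ Finset.range m, 1 / (i : ℝ)) atTop atTop :=
    (not_summable_iff_tendsto_nat_atTop_of_nonneg fun i => by positivity).1
      Real.not_summable_one_div_natCast
  obtain ⟨m, hm, hsm⟩ := ((hdiv.eventually_gt_atTop (T + ∑ i ∈ Finset.range s, 1 / (i : ℝ))).and
    (eventually_ge_atTop s)).exists
  exact ⟨m, by rw [Finset.sum_Ico_eq_sub _ hsm]; exact lt_sub_iff_add_lt.2 hm⟩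

theorem rescaledTime_zero : rescaledTime 0 = 0 := by simp [rescaledTime]

theorem rescaledTime_succ (n : ℕ) : rescaledTime (n + 1) = rescaledTime n + 1 / ((n : ℝ) + 1) := by
  rw [rescaledTime, Finset.sum_Icc_succ_top (by omega), rescaledTime, Nat.cast_succ]

theorem rescaledTime_strictMono : StrictMono rescaledTime :=
  strictMono_nat_of_lt_succ fun n => by
    rw [rescaledTime_succ]
    exact lt_add_of_pos_right _ (by positivity)

theorem rescaledTime_nonneg (n : ℕ) : 0 ≤ rescaledTime n :=
  rescaledTime_zero ▸ rescaledTime_strictMono.monotone n.zero_le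

theorem sum_Ico_one_div {s m : ℕ} (hsm : s ≤ m) :
    ∑ i ∈ Finset.Ico s m, 1 / (i : ℝ) =
      rescaledTime m - rescaledTime s + 1 / (s : ℝ) - 1 / (m : ℝ) := by
  induction m, hsm using Nat.le_induction with
  | base => simp
  | succ m hm ih =>
    rw [Finset.sum_Ico_succ_top hm, ih, rescaledTime_succ, Nat.cast_succ]
    ring

theorem tendsto_rescaledTime_sub_log :
    Tendsto (fun n : ℕ => rescaledTime n - Real.log n) atTop
      (𝓝 Real.eulerMascheroniConstant) := by
  refine Real.tendsto_harmonic_sub_log.congr fun n => ?_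
  simp only [rescaledTime, harmonic_eq_sum_Icc, Rat.cast_sum, Rat.cast_inv, Rat.cast_natCast,
    one_div]

theorem tendsto_rescaledTime_atTop : Tendsto rescaledTime atTop atTop :=
  ((Real.tendsto_log_atTop.comp tendsto_natCast_atTop_atTop).atTop_add
    tendsto_rescaledTime_sub_log).congr fun _ => add_sub_cancel _ _

theorem tendsto_div_of_tendsto_rescaledTime_sub {M N : ℕ → ℕ} {h : ℝ}
    (hM : Tendsto M atTop atTop) (hN : Tendsto N atTop atTop)
    (hMN : Tendsto (fun n => rescaledTime (N n) - rescaledTime (M n)) atTop (𝓝 h)) :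
    Tendsto (fun n => (M n : ℝ) / N n) atTop (𝓝 (Real.exp (-h))) := by
  have hlog : Tendsto (fun n => Real.log (M n) - Real.log (N n)) atTop (𝓝 (-h)) := by
    have hγ := ((tendsto_rescaledTime_sub_log.comp hN).sub
      (tendsto_rescaledTime_sub_log.comp hM)).sub hMN
    rw [sub_self, zero_sub] at hγ
    refine hγ.congr fun n => ?_
    simp only [Function.comp_apply]
    ring
  refine ((Real.continuous_exp.tendsto _).comp hlog).congr' ?_
  filter_upwards [hM.eventually_gt_atTop 0, hN.eventually_gt_atTop 0] with n hm hn
  rw [Function.comp_apply, Real.exp_sub, Real.exp_log (Nat.cast_pos.2 hm),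
    Real.exp_log (Nat.cast_pos.2 hn)]

theorem exists_rescaledTime_le_lt_succ {t : ℝ} (ht : 0 ≤ t) :
    ∃ n : ℕ, rescaledTime n ≤ t ∧ t < rescaledTime (n + 1) :=
  exists_le_lt_succ (rescaledTime_zero.trans_le ht)
    (tendsto_rescaledTime_atTop.eventually_gt_atTop t).exists

variable {E : Type*} [NormedAddCommGroup E] [NormedSpace ℝ E]

theorem tendsto_inv_smul_sub_smul {M N : ℕ → ℕ} {a : ℕ → E} {r : ℝ} {α β : E}
    (hN : Tendsto N atTop atTop) (hr : r ≠ 1)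
    (hMN : Tendsto (fun n => (M n : ℝ) / N n) atTop (𝓝 r))
    (hα : Tendsto (fun n => a (M n)) atTop (𝓝 α))
    (hβ : Tendsto (fun n => a (N n)) atTop (𝓝 β)) :
    Tendsto (fun n => ((N n : ℝ) - M n)⁻¹ • ((N n : ℝ) • a (N n) - (M n : ℝ) • a (M n))) atTop
      (𝓝 ((1 - r)⁻¹ • (β - r • α))) := by
  refine (((hMN.const_sub 1).inv₀ (sub_ne_zero.2 hr.symm)).smul
    (hβ.sub (hMN.smul hα))).congr' ?_
  filter_upwards [hN.eventually_gt_atTop 0] with n hn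
  have hn' : (N n : ℝ) ≠ 0 := Nat.cast_ne_zero.2 hn.ne'
  have hinv : (1 - (M n : ℝ) / N n)⁻¹ = ((N n : ℝ) - M n)⁻¹ * N n := by
    rw [one_sub_div hn', inv_div, div_eq_inv_mul]
  rw [hinv, mul_smul, smul_sub (N n : ℝ), smul_smul, mul_div_cancel₀ _ hn']

theorem tendsto_natCast_sub_atTop {M N : ℕ → ℕ} {r : ℝ} (hN : Tendsto N atTop atTop) (hr : r < 1)
    (hMN : Tendsto (fun n => (M n : ℝ) / N n) atTop (𝓝 r)) :
    Tendsto (fun n => (N n : ℝ) - M n) atTop atTop := by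
  refine ((tendsto_natCast_atTop_atTop.comp hN).atTop_mul_pos (sub_pos.2 hr)
    (hMN.const_sub 1)).congr' ?_
  filter_upwards [hN.eventually_gt_atTop 0] with n hn
  rw [Function.comp_apply, mul_sub, mul_one, mul_div_cancel₀ _ (Nat.cast_ne_zero.2 hn.ne')]

theorem tendsto_inv_smul_sum_Ico_zero {M N : ℕ → ℕ} {f : ℕ → E} {r : ℝ}
    (hM : Tendsto M atTop atTop) (hN : Tendsto N atTop atTop) (hr : r < 1)
    (hMN : Tendsto (fun n => (M n : ℝ) / N n) atTop (𝓝 r))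
    (hf : Tendsto (fun n : ℕ => (n : ℝ)⁻¹ • ∑ i ∈ Finset.range n, f i) atTop (𝓝 0)) :
    Tendsto (fun n => ((N n : ℝ) - M n)⁻¹ • ∑ i ∈ Finset.Ico (M n) (N n), f i) atTop (𝓝 0) := by
  have hlim := tendsto_inv_smul_sub_smul (a := fun n : ℕ => (n : ℝ)⁻¹ • ∑ i ∈ Finset.range n, f i)
    hN hr.ne hMN (hf.comp hM) (hf.comp hN)
  rw [smul_zero, sub_zero, smul_zero] at hlim
  refine hlim.congr' ?_
  filter_upwards [hM.eventually_gt_atTop 0,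
    (tendsto_natCast_sub_atTop hN hr hMN).eventually_gt_atTop 0] with n hm hmn
  have hmn' : M n < N n := Nat.cast_lt.1 (sub_pos.1 hmn)
  rw [smul_inv_smul₀ (Nat.cast_ne_zero.2 (hm.trans hmn').ne'),
    smul_inv_smul₀ (Nat.cast_ne_zero.2 hm.ne'), Finset.sum_Ico_eq_sub _ hmn'.le]

end RescaledTime

section Interpolation

variable {d : ℕ} {x : ℕ → Vec d}

theorem interpolate_eq_lineMap {t : ℝ} {n : ℕ} (hn : rescaledTime n ≤ t)
    (hn' : t < rescaledTime (n + 1)) :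
    interpolate x t =
      AffineMap.lineMap (x n) (x (n + 1)) ((t - rescaledTime n) * ((n : ℝ) + 1)) := by
  have hsInf : sInf {n : ℕ | t < rescaledTime (n + 1)} = n := by
    refine le_antisymm (Nat.sInf_le hn') (le_csInf ⟨n, hn'⟩ fun k hk => ?_)
    exact Nat.lt_succ_iff.1 (rescaledTime_strictMono.lt_iff_lt.1 (hn.trans_lt hk))
  have hne : (n : ℝ) + 1 ≠ 0 := by positivity
  rw [interpolate, hsInf, AffineMap.lineMap_apply_module, rescaledTime_succ]
  congr 2 <;> field_simp <;> ring

theorem interpolate_rescaledTime (x : ℕ → Vec d) (n : ℕ) :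
    interpolate x (rescaledTime n) = x n := by
  rw [interpolate_eq_lineMap le_rfl (rescaledTime_strictMono n.lt_succ_self), sub_self, zero_mul,
    AffineMap.lineMap_apply_zero]

theorem interpolate_eq_lineMap_of_mem_Icc {t : ℝ} {n : ℕ}
    (ht : t ∈ Set.Icc (rescaledTime n) (rescaledTime (n + 1))) :
    interpolate x t =
      AffineMap.lineMap (x n) (x (n + 1)) ((t - rescaledTime n) * ((n : ℝ) + 1)) := by
  rcases ht.2.lt_or_eq with h | rfl
  · exact interpolate_eq_lineMap ht.1 h
  · have hne : (n : ℝ) + 1 ≠ 0 := by positivity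
    rw [interpolate_rescaledTime, rescaledTime_succ, add_sub_cancel_left, one_div_mul_cancel hne,
      AffineMap.lineMap_apply_one]

theorem dist_interpolate_le_of_mem_Icc {V : ℝ} {n : ℕ}
    (hx : dist (x n) (x (n + 1)) ≤ V / ((n : ℝ) + 1)) {s t : ℝ}
    (hs : s ∈ Set.Icc (rescaledTime n) (rescaledTime (n + 1)))
    (ht : t ∈ Set.Icc (rescaledTime n) (rescaledTime (n + 1))) :
    dist (interpolate x s) (interpolate x t) ≤ V * dist s t := by
  rw [interpolate_eq_lineMap_of_mem_Icc hs, interpolate_eq_lineMap_of_mem_Icc ht,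
    dist_lineMap_lineMap, Real.dist_eq, Real.dist_eq, ← sub_mul, sub_sub_sub_cancel_right, abs_mul,
    abs_of_pos (a := (n : ℝ) + 1) (by positivity), mul_assoc, mul_comm V]
  gcongr
  rwa [mul_comm, ← le_div_iff₀ (Nat.cast_add_one_pos n)]

theorem dist_le_mul_rescaledTime_sub {V : ℝ}
    (hx : ∀ n, dist (x n) (x (n + 1)) ≤ V / ((n : ℝ) + 1)) {m n : ℕ} (hmn : m ≤ n) :
    dist (x m) (x n) ≤ V * (rescaledTime n - rescaledTime m) := by
  rw [← Finset.sum_Ico_sub rescaledTime hmn, Finset.mul_sum]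
  refine dist_le_Ico_sum_of_dist_le hmn fun {k} _ _ => (hx k).trans_eq ?_
  rw [rescaledTime_succ, add_sub_cancel_left, mul_one_div]

theorem lipschitzOnWith_interpolate {V : NNReal}
    (hx : ∀ n, dist (x n) (x (n + 1)) ≤ V / ((n : ℝ) + 1)) :
    LipschitzOnWith V (interpolate x) (Set.Ici 0) := by
  refine LipschitzOnWith.of_dist_le_mul fun s hs t ht => ?_
  wlog hst : s ≤ t generalizing s t
  · rw [dist_comm, dist_comm s]
    exact this t ht s hs (le_of_not_ge hst)
  obtain ⟨m, hm, hm'⟩ := exists_rescaledTime_le_lt_succ hs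
  obtain ⟨n, hn, hn'⟩ := exists_rescaledTime_le_lt_succ ht
  have hmn : m ≤ n := Nat.lt_succ_iff.1
    (rescaledTime_strictMono.lt_iff_lt.1 ((hm.trans hst).trans_lt hn'))
  rcases hmn.eq_or_lt with rfl | hlt
  · exact dist_interpolate_le_of_mem_Icc (hx m) ⟨hm, hm'.le⟩ ⟨hn, hn'.le⟩
  have hleft := dist_interpolate_le_of_mem_Icc (hx m) ⟨hm, hm'.le⟩
    ⟨(rescaledTime_strictMono m.lt_succ_self).le, le_rfl⟩
  have hright := dist_interpolate_le_of_mem_Icc (hx n)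
    ⟨le_rfl, (rescaledTime_strictMono n.lt_succ_self).le⟩ ⟨hn, hn'.le⟩
  have hmiddle := dist_le_mul_rescaledTime_sub hx hlt
  rw [interpolate_rescaledTime] at hleft hright
  refine (dist_triangle4 _ (x (m + 1)) (x n) _).trans
    ((add_le_add (add_le_add hleft hmiddle) hright).trans_eq ?_)
  rw [dist_comm s, dist_comm _ t, dist_comm s, Real.dist_eq, Real.dist_eq, Real.dist_eq,
    abs_of_nonneg (sub_nonneg.2 hm'.le), abs_of_nonneg (sub_nonneg.2 hn),
    abs_of_nonneg (sub_nonneg.2 hst)]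
  ring

end Interpolation

section Average

variable {d : ℕ} {x₀ : Vec d} {r : ℕ → Vec d}

theorem average_succ (n : ℕ) :
    average x₀ r (n + 1) =
      average x₀ r n + (1 / ((n : ℝ) + 1)) • (r n - average x₀ r n) := rfl

theorem natCast_smul_average_sub {m n : ℕ} (hmn : m ≤ n) :
    (n : ℝ) • average x₀ r n - (m : ℝ) • average x₀ r m = ∑ i ∈ Finset.Ico m n, r i := by
  have hstep (k : ℕ) : ((k + 1 : ℕ) : ℝ) • average x₀ r (k + 1) - (k : ℝ) • average x₀ r k =
      r k := by
    have hne : (k : ℝ) + 1 ≠ 0 := by positivity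
    rw [average_succ, Nat.cast_succ, smul_add, smul_smul, mul_one_div_cancel hne]
    module
  simp only [← Finset.sum_Ico_sub (fun k : ℕ => (k : ℝ) • average x₀ r k) hmn, hstep]

theorem average_succ_mem {A : Set (Vec d)} (hA : Convex ℝ A) (hr : ∀ n, r n ∈ A) (n : ℕ) :
    average x₀ r (n + 1) ∈ A := by
  induction n with
  | zero => simpa [average] using hr 0
  | succ n ih =>
    rw [average_succ]
    refine hA.add_smul_sub_mem ih (hr _) ⟨by positivity, ?_⟩
    rw [div_le_one (by positivity)]
    exact le_add_of_nonneg_left (Nat.cast_nonneg _)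

theorem tendsto_inv_smul_sum_Ico_of_tendsto_average {M N : ℕ → ℕ} {ρ : ℝ} {α β : Vec d}
    (hN : Tendsto N atTop atTop) (hρ : ρ < 1)
    (hMN : Tendsto (fun n => (M n : ℝ) / N n) atTop (𝓝 ρ))
    (hα : Tendsto (fun n => average x₀ r (M n)) atTop (𝓝 α))
    (hβ : Tendsto (fun n => average x₀ r (N n)) atTop (𝓝 β)) :
    Tendsto (fun n => ((N n : ℝ) - M n)⁻¹ • ∑ i ∈ Finset.Ico (M n) (N n), r i) atTop
      (𝓝 ((1 - ρ)⁻¹ • (β - ρ • α))) := by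
  refine (tendsto_inv_smul_sub_smul hN hρ.ne hMN hα hβ).congr' ?_
  filter_upwards [(tendsto_natCast_sub_atTop hN hρ hMN).eventually_gt_atTop 0] with n hn
  rw [natCast_smul_average_sub (Nat.cast_le.1 (sub_pos.1 hn).le)]

end Average

section Target

variable {S Up Ua : Type*} [Fintype S] {d : ℕ} {G : Game S Up Ua d}

namespace Game

theorem infDist_pos_of_notMem_closure (hD : G.D.Nonempty) {x : Vec d} (hx : x ∉ closure G.D) :
    0 < Metric.infDist x G.D := by
  rw [← Metric.infDist_closure]
  exact (isClosed_closure.notMem_iff_infDist_pos hD.closure).1 hx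

theorem notMem_closure_of_infDist_pos {x : Vec d} (hx : 0 < Metric.infDist x G.D) :
    x ∉ closure G.D := fun h =>
  hx.ne' (Metric.infDist_zero_of_mem_closure h)

theorem layer_subset (n : ℕ) : G.layer n ⊆ G.K \ closure G.D := fun _ hy =>
  ⟨hy.1, notMem_closure_of_infDist_pos (one_div_pos.2 (Nat.cast_add_one_pos n) |>.trans_le hy.2.1)⟩

theorem exists_le_mem_layer {x : Vec d} (hx : x ∈ G.K) {n : ℕ}
    (hn : 1 / ((n : ℝ) + 1) ≤ Metric.infDist x G.D) : ∃ k ≤ n, x ∈ G.layer k := by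
  classical
  have hex : ∃ k : ℕ, 1 / ((k : ℝ) + 1) ≤ Metric.infDist x G.D := ⟨n, hn⟩
  refine ⟨Nat.find hex, Nat.find_min' hex hn, hx, Nat.find_spec hex, fun hne => ?_⟩
  obtain ⟨k, hk⟩ := Nat.exists_eq_add_one_of_ne_zero hne
  rw [hk, Nat.cast_succ]
  exact (not_le.1 (Nat.find_min hex (hk ▸ k.lt_succ_self))).le

theorem proj_spec (hD : G.D.Nonempty) (x : Vec d) :
    G.proj x ∈ closure G.D ∧ ∀ z ∈ closure G.D, ‖x - G.proj x‖ ≤ ‖x - z‖ := by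
  obtain ⟨y, hy, hxy⟩ := isClosed_closure.exists_infDist_eq_dist hD.closure x
  have hmin : ∀ z ∈ closure G.D, ‖x - y‖ ≤ ‖x - z‖ := fun z hz => by
    rw [← dist_eq_norm, ← dist_eq_norm, ← hxy]
    exact Metric.infDist_le_dist_of_mem hz
  exact Classical.epsilon_spec
    (p := fun y => y ∈ closure G.D ∧ ∀ z ∈ closure G.D, ‖x - y‖ ≤ ‖x - z‖) ⟨y, hy, hmin⟩

theorem norm_sub_proj (hD : G.D.Nonempty) (x : Vec d) :
    ‖x - G.proj x‖ = Metric.infDist x G.D := by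
  obtain ⟨hmem, hmin⟩ := proj_spec hD x
  rw [← Metric.infDist_closure]
  refine le_antisymm ((Metric.le_infDist hD.closure).2 fun z hz => ?_) ?_
  · exact (hmin z hz).trans_eq (dist_eq_norm x z).symm
  · exact (Metric.infDist_le_dist_of_mem hmem).trans_eq (dist_eq_norm _ _)

theorem proj_eq_self (hD : G.D.Nonempty) {x : Vec d} (hx : x ∈ closure G.D) : G.proj x = x := by
  have hzero := norm_sub_proj hD x
  rw [Metric.infDist_zero_of_mem_closure hx, norm_sub_eq_zero_iff] at hzero
  exact hzero.symm

/-- A sequence in `K` whose steps are bounded like those of a running average of rewards; this is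
all that the geometry of a scheme uses about `(x_n)`. -/
structure IsAdmissible (G : Game S Up Ua d) (x : ℕ → Vec d) : Prop where
  mem : ∀ n, x n ∈ G.K
  dist_le : ∀ n, dist (x n) (x (n + 1)) ≤ G.vmax / ((n : ℝ) + 1)

theorem IsAdmissible.vmax_nonneg {x : ℕ → Vec d} (hx : G.IsAdmissible x) : 0 ≤ G.vmax := by
  simpa only [CharP.cast_eq_zero, zero_add, div_one] using dist_nonneg.trans (hx.dist_le 0)

theorem IsAdmissible.lipschitzOnWith_interpolate {x : ℕ → Vec d} (hx : G.IsAdmissible x) :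
    LipschitzOnWith G.vmax.toNNReal (interpolate x) (Set.Ici 0) :=
  Approach.lipschitzOnWith_interpolate fun n => (hx.dist_le n).trans <| by
    gcongr
    exact Real.le_coe_toNNReal _

variable [Finite Up] [Finite Ua]

theorem norm_sub_le_vmax (hK : Bornology.IsBounded G.K) {x : Vec d} (hx : x ∈ G.K) (θ : S)
    (a : Up) (b : Ua) : ‖G.κ θ a b - x‖ ≤ G.vmax := by
  obtain ⟨R, hR⟩ := ((finite_setOf_reward G).isBounded.sub hK).exists_norm_le
  refine le_csSup ⟨R, ?_⟩ ⟨x, hx, θ, a, b, rfl⟩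
  rintro _ ⟨x, hx, θ, a, b, rfl⟩
  exact hR _ (Set.sub_mem_sub ⟨θ, a, b, rfl⟩ hx)

end Game

end Target

namespace Scheme

section Centres

variable {S Up Ua : Type*} [Fintype S] [Fintype Up] [Fintype Ua] {d : ℕ} {G : Game S Up Ua d}
variable (C : Scheme G)

theorem isAdmissible_path (hK : Bornology.IsBounded G.K)
    (hκ : convexHull ℝ {r | ∃ θ a b, r = G.κ θ a b} ⊆ G.K) {Ω : Type*} {x₀ : Vec d}
    (hx₀ : x₀ ∈ G.K) (θ : ℕ → Ω → S) (up : ℕ → Ω → Up) (ua : ℕ → Ω → Ua) (ω : Ω) :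
    G.IsAdmissible (C.path x₀ θ up ua ω) := by
  have hreward (i : ℕ) : G.κ (θ i ω) (up i ω) (ua i ω) ∈
      convexHull ℝ {r | ∃ θ a b, r = G.κ θ a b} := subset_convexHull ℝ _ ⟨_, _, _, rfl⟩
  have hmem : ∀ n, C.path x₀ θ up ua ω n ∈ G.K
    | 0 => hx₀
    | n + 1 => hκ (average_succ_mem (convex_convexHull ℝ _) hreward n)
  refine ⟨hmem, fun n => ?_⟩
  rw [dist_eq_norm', path, average_succ, add_sub_cancel_left, norm_smul,
    Real.norm_of_nonneg (by positivity), one_div_mul_eq_div]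
  gcongr
  exact Game.norm_sub_le_vmax hK (hmem n) _ _ _

theorem centres_subset : C.centres ⊆ G.K \ closure G.D :=
  Set.iUnion_subset fun n => (C.net_subset n).trans (Game.layer_subset n)

theorem exists_mem_net {x : Vec d} {k : ℕ} (hx : x ∈ G.layer k) :
    ∃ q ∈ C.net k, x ∈ Metric.ball q (C.ρ q / 2) := by
  simpa using C.net_covers k hx

variable {C}

theorem vmax_pos_of_mem_centres {q : Vec d} (hq : q ∈ C.centres) : 0 < G.vmax := by
  have hT := (C.T_bounds q hq).1.trans (C.T_bounds q hq).2
  rw [div_mul_eq_div_div_swap, div_mul_eq_div_div_swap] at hT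
  exact (div_pos_iff_of_pos_left (C.ρ_pos q (C.centres_subset hq))).1 (by linarith)

theorem T_pos {q : Vec d} (hq : q ∈ C.centres) : 0 < C.T q := by
  have hv := vmax_pos_of_mem_centres hq
  have hρ := C.ρ_pos q (C.centres_subset hq)
  exact lt_trans (by positivity) (C.T_bounds q hq).1

theorem vmax_mul_T_lt {q : Vec d} (hq : q ∈ C.centres) : G.vmax * C.T q < C.ρ q / 3 := by
  have hv := vmax_pos_of_mem_centres hq
  have hT := (C.T_bounds q hq).2
  rw [div_mul_eq_div_div, lt_div_iff₀ hv] at hT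
  rwa [mul_comm]

-- At a point `z` of the target the separating inner product would be `⟪·, z - z⟫ = 0`.
theorem ρ_le_infDist [Nonempty Ua] (hD : G.D.Nonempty) {q : Vec d} (hq : q ∈ C.centres) :
    C.ρ q ≤ Metric.infDist q G.D := by
  obtain ⟨ε, hε, hsep⟩ := C.separates q (C.centres_subset hq)
  refine (Metric.le_infDist hD).2 fun z hz => ?_
  by_contra! hlt
  have hle := hsep z (Metric.mem_ball'.2 hlt) (Classical.arbitrary _)
  rw [Game.proj_eq_self hD (subset_closure hz), sub_self, inner_zero_right] at hle
  exact hε.not_ge hle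

theorem Q_spec (hD : G.D.Nonempty) {x : Vec d} (hx : x ∈ G.K \ closure G.D) :
    C.Q x ∈ C.centres ∧ x ∈ Metric.ball (C.Q x) (C.ρ (C.Q x) / 2) ∧
      ∀ q ∈ C.centres, x ∈ Metric.ball q (C.ρ q / 2) → C.index (C.Q x) ≤ C.index q := by
  obtain ⟨n, hn⟩ := exists_nat_one_div_lt (Game.infDist_pos_of_notMem_closure hD hx.2)
  obtain ⟨k, -, hk⟩ := Game.exists_le_mem_layer hx.1 hn.le
  obtain ⟨q, hq, hxq⟩ := C.exists_mem_net hk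
  have hne : {q ∈ C.centres | x ∈ Metric.ball q (C.ρ q / 2)}.Nonempty :=
    ⟨q, Set.mem_iUnion.2 ⟨k, hq⟩, hxq⟩
  rw [Q, dif_pos hne]
  obtain ⟨hmem, hball⟩ := Function.argminOn_mem C.index _ hne
  refine ⟨hmem, hball, fun q hq hxq => Function.argminOn_le C.index _ ?_⟩
  exact ⟨hq, hxq⟩

theorem finite_image_Q (hD : G.D.Nonempty) {c : ℝ} (hc : 0 < c) :
    (C.Q '' {x ∈ G.K | c ≤ Metric.infDist x G.D}).Finite := by
  obtain ⟨n, hn⟩ := exists_nat_one_div_lt hc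
  set B : ℕ := (Finset.range (n + 1)).sup fun k => (C.net k).sup C.index
  refine Set.Finite.of_injOn (f := C.index) (t := Set.Iic B) ?_ (C.index_injOn.mono ?_)
    (Set.finite_Iic B)
  · rintro _ ⟨x, ⟨hxK, hxc⟩, rfl⟩
    obtain ⟨k, hkn, hk⟩ := Game.exists_le_mem_layer hxK (hn.le.trans hxc)
    obtain ⟨q, hq, hxq⟩ := C.exists_mem_net hk
    calc C.index (C.Q x) ≤ C.index q :=
          (C.Q_spec hD (G.layer_subset k hk)).2.2 q (Set.mem_iUnion.2 ⟨k, hq⟩) hxq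
      _ ≤ (C.net k).sup C.index := Finset.le_sup hq
      _ ≤ B := Finset.le_sup (f := fun k => (C.net k).sup C.index)
          (Finset.mem_range.2 (Nat.lt_succ_of_le hkn))
  · rintro _ ⟨x, ⟨hxK, hxc⟩, rfl⟩
    exact (Q_spec hD ⟨hxK, Game.notMem_closure_of_infDist_pos (hc.trans_le hxc)⟩).1

end Centres

section Switching

variable {S Up Ua : Type*} [Fintype S] [Fintype Up] [Fintype Ua] {d : ℕ} {G : Game S Up Ua d}
variable {C : Scheme G} {x : ℕ → Vec d} (hD : G.D.Nonempty)

include hD in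
theorem exists_nextSwitch_eq_succ {s : ℕ} (hs : x s ∈ G.K \ closure G.D) :
    ∃ m, max s 1 ≤ m ∧ C.nextSwitch x s = m + 1 ∧
      ∑ i ∈ Finset.Ico (max s 1) m, 1 / (i : ℝ) ≤ C.T (C.Q (x s)) ∧
      C.T (C.Q (x s)) < ∑ i ∈ Finset.Ico (max s 1) (m + 1), 1 / (i : ℝ) := by
  rw [nextSwitch, if_neg hs.2]
  exact exists_sInf_lt_sum_Ico_eq_succ (T_pos (C.Q_spec hD hs).1).le
    (exists_lt_sum_Ico_one_div _ _)

include hD in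
theorem abs_rescaledTime_nextSwitch_sub_le {s : ℕ} (hs₀ : 0 < s) (hs : x s ∈ G.K \ closure G.D) :
    |rescaledTime (C.nextSwitch x s) - rescaledTime s - C.T (C.Q (x s))| ≤ 1 / (s : ℝ) := by
  obtain ⟨m, hsm, hm, hle, hlt⟩ := exists_nextSwitch_eq_succ (C := C) hD hs
  rw [max_eq_left (Nat.succ_le_of_lt hs₀)] at hsm hle hlt
  have hanti {k : ℕ} (hk : s ≤ k) : 1 / (k : ℝ) ≤ 1 / (s : ℝ) :=
    one_div_le_one_div_of_le (Nat.cast_pos.2 hs₀) (Nat.cast_le.2 hk)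
  have hm_le := hanti hsm
  have hm_succ_le := hanti (hsm.trans m.le_succ)
  have hpos : 0 ≤ 1 / ((m : ℝ) + 1) := by positivity
  rw [sum_Ico_one_div hsm] at hle
  rw [sum_Ico_one_div (hsm.trans m.le_succ), rescaledTime_succ, Nat.cast_succ] at hlt
  rw [Nat.cast_succ] at hm_succ_le
  rw [hm, rescaledTime_succ, abs_le]
  constructor <;> linarith

variable (hx : ∀ n, x n ∈ G.K)
include hD hx

theorem lt_nextSwitch (s : ℕ) : s < C.nextSwitch x s := by
  by_cases hs : x s ∈ closure G.D
  · rw [nextSwitch, if_pos hs]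
    exact s.lt_succ_self
  · obtain ⟨m, hsm, hm, -⟩ := exists_nextSwitch_eq_succ (C := C) hD ⟨hx s, hs⟩
    omega

theorem strictMono_switchTime : StrictMono (C.switchTime x) :=
  strictMono_nat_of_lt_succ fun n => lt_nextSwitch hD hx (C.switchTime x n)

theorem period_eq {m n : ℕ} (hm : C.switchTime x m ≤ n) (hm' : n < C.switchTime x (m + 1)) :
    C.period x n = m := by
  have hmono := strictMono_switchTime (C := C) hD hx
  refine Nat.findGreatest_eq_iff.2 ⟨(hmono.id_le m).trans hm, fun _ => hm, fun k hk _ hkn => ?_⟩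
  exact (hm'.trans_le (hmono.monotone hk)).not_ge hkn

theorem playerStrategy_eq {m n : ℕ} (hm : C.switchTime x m ≤ n)
    (hm' : n < C.switchTime x (m + 1)) (hxm : x (C.switchTime x m) ∉ closure G.D) :
    C.playerStrategy x n = C.strat (C.Q (x (C.switchTime x m))) := by
  rw [playerStrategy, period_eq hD hx hm hm']
  exact if_neg hxm

end Switching

end Scheme

section Trajectories

theorem natCast_mul_div_two_pow_mem_Icc {T : ℝ} (hT : 0 ≤ T) {j k : ℕ} (hj : j ≤ 2 ^ k) :
    (j : ℝ) * (T / 2 ^ k) ∈ Set.Icc 0 T := by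
  refine ⟨by positivity, ?_⟩
  rw [mul_div_assoc', div_le_iff₀ (by positivity), mul_comm]
  gcongr
  exact_mod_cast hj

variable {S Up Ua : Type*} [Fintype S] [Fintype Up] [Fintype Ua] {d : ℕ} {G : Game S Up Ua d}

namespace Scheme

variable {C : Scheme G} {x : ℕ → Vec d}

/-- The length of the `m`-th holding period in the rescaled time `t(n)`. -/
def holdingLength (C : Scheme G) (x : ℕ → Vec d) (m : ℕ) : ℝ :=
  rescaledTime (C.switchTime x (m + 1)) - rescaledTime (C.switchTime x m)

theorem trajectory_eq_interpolate_min (m : ℕ) (t : ℝ) :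
    C.trajectory x m t =
      interpolate x (rescaledTime (C.switchTime x m) + min t (C.holdingLength x m)) := by
  rw [trajectory, ← holdingLength]
  split_ifs with h
  · rw [min_eq_left h]
  · rw [min_eq_right (not_le.1 h).le, holdingLength, add_sub_cancel]

theorem trajectory_of_holdingLength_le {m : ℕ} {t : ℝ} (h : C.holdingLength x m ≤ t) :
    C.trajectory x m t = x (C.switchTime x (m + 1)) := by
  rw [trajectory_eq_interpolate_min, min_eq_right h, holdingLength, add_sub_cancel,
    interpolate_rescaledTime]

variable (hD : G.D.Nonempty)
include hD

theorem holdingLength_pos (hx : ∀ n, x n ∈ G.K) (m : ℕ) : 0 < C.holdingLength x m :=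
  sub_pos.2 (rescaledTime_strictMono (strictMono_switchTime hD hx m.lt_succ_self))

theorem trajectory_zero (hx : ∀ n, x n ∈ G.K) (m : ℕ) :
    C.trajectory x m 0 = x (C.switchTime x m) := by
  rw [trajectory_eq_interpolate_min, min_eq_left (holdingLength_pos hD hx m).le, add_zero,
    interpolate_rescaledTime]

theorem lipschitzOnWith_trajectory (hx : G.IsAdmissible x) (m : ℕ) :
    LipschitzOnWith G.vmax.toNNReal (C.trajectory x m) (Set.Ici 0) := by
  set s := rescaledTime (C.switchTime x m)
  have hclock : LipschitzWith 1 fun t => s + min t (C.holdingLength x m) :=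
    (one_mul (1 : NNReal)) ▸ (isometry_add_left s).lipschitz.comp
      (LipschitzWith.id.min_const (C.holdingLength x m))
  have hmaps : Set.MapsTo (fun t => s + min t (C.holdingLength x m)) (Set.Ici 0) (Set.Ici 0) :=
    fun t ht => add_nonneg (rescaledTime_nonneg _)
      (le_min ht (holdingLength_pos hD hx.mem m).le)
  rw [funext (trajectory_eq_interpolate_min m), ← mul_one G.vmax.toNNReal]
  exact hx.lipschitzOnWith_interpolate.comp hclock.lipschitzOnWith hmaps

theorem exists_index_near_trajectory (hx : G.IsAdmissible x) (m : ℕ) {t : ℝ} (ht : 0 ≤ t) :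
    ∃ N, C.switchTime x m ≤ N ∧ N ≤ C.switchTime x (m + 1) ∧
      dist (rescaledTime N - rescaledTime (C.switchTime x m)) (min t (C.holdingLength x m)) ≤
        1 / ((C.switchTime x m : ℝ) + 1) ∧
      dist (x N) (C.trajectory x m t) ≤
        G.vmax.toNNReal * (1 / ((C.switchTime x m : ℝ) + 1)) := by
  set s := C.switchTime x m
  set τ := min t (C.holdingLength x m) with hτ
  have hτ₀ : 0 ≤ τ := le_min ht (holdingLength_pos hD hx.mem m).le
  have hτ_le : rescaledTime s + τ ≤ rescaledTime (C.switchTime x (m + 1)) :=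
    le_sub_iff_add_le'.1 (min_le_right _ _)
  obtain ⟨N, hN, hN'⟩ :=
    exists_rescaledTime_le_lt_succ (add_nonneg (rescaledTime_nonneg s) hτ₀)
  have hsN : s ≤ N := Nat.lt_succ_iff.1
    (rescaledTime_strictMono.lt_iff_lt.1 ((le_add_of_nonneg_right hτ₀).trans_lt hN'))
  have hdist : dist (rescaledTime N) (rescaledTime s + τ) ≤ 1 / ((s : ℝ) + 1) := by
    have hanti : 1 / ((N : ℝ) + 1) ≤ 1 / ((s : ℝ) + 1) := by gcongr
    rw [rescaledTime_succ] at hN'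
    rw [dist_comm, Real.dist_eq, abs_of_nonneg (sub_nonneg.2 hN)]
    linarith
  refine ⟨N, hsN, rescaledTime_strictMono.le_iff_le.1 (hN.trans hτ_le), ?_, ?_⟩
  · rwa [Real.dist_eq, sub_sub, ← Real.dist_eq]
  · have hlip := hx.lipschitzOnWith_interpolate.dist_le_mul _ (rescaledTime_nonneg N) _
      (add_nonneg (rescaledTime_nonneg s) hτ₀)
    rw [interpolate_rescaledTime, hτ, ← trajectory_eq_interpolate_min] at hlip
    exact hlip.trans (by gcongr)

omit hD

/-- `y` is the limit, uniform on compact sets, of the trajectories over the holding periods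
`m 0 < m 1 < …`, all of which use the centre `q`; these are the limits in the definition of
`N(q, j, k)`. -/
structure IsLimitTrajectory (C : Scheme G) (x : ℕ → Vec d) (q : Vec d) (m : ℕ → ℕ)
    (y : ℝ → Vec d) : Prop where
  strictMono : StrictMono m
  start_mem : ∀ n, x (C.switchTime x (m n)) ∈ G.K \ closure G.D
  centre_eq : ∀ n, C.Q (x (C.switchTime x (m n))) = q
  tendstoUniformlyOn : ∀ b : ℝ,
    TendstoUniformlyOn (fun n => C.trajectory x (m n)) y atTop (Set.Icc 0 b)

theorem notMem_exceptional_iff : x ∉ C.exceptional ↔ ∀ q ∈ C.centres, ∀ m y,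
    C.IsLimitTrajectory x q m y → ∀ k, ∀ j < 2 ^ k,
      dyadicReward y (C.T q) j k ∈ closure (G.rewardSet (C.strat q)) := by
  simp only [exceptional, exceptionalAt, Set.mem_iUnion, Finset.mem_range, Set.mem_ofPred_eq,
    not_exists, not_and, not_not, exists_prop]
  exact ⟨fun h q hq m y hy k j hj => h q hq k j hj m hy.strictMono
      (fun n => ⟨hy.start_mem n, hy.centre_eq n⟩) y hy.tendstoUniformlyOn,
    fun h q hq k j hj m hm hstart y hy => h q hq m y ⟨hm, fun n => (hstart n).1,
      fun n => (hstart n).2, hy⟩ k j hj⟩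

namespace IsLimitTrajectory

variable {q : Vec d} {m : ℕ → ℕ} {y : ℝ → Vec d} (hy : C.IsLimitTrajectory x q m y)
include hy

theorem tendsto_trajectory {t : ℝ} (ht : 0 ≤ t) :
    Tendsto (fun n => C.trajectory x (m n) t) atTop (𝓝 (y t)) :=
  (hy.tendstoUniformlyOn t).tendsto_at ⟨ht, le_rfl⟩

variable (hD : G.D.Nonempty)
include hD

theorem centre_mem : q ∈ C.centres :=
  hy.centre_eq 0 ▸ (Q_spec hD (hy.start_mem 0)).1

theorem tendsto_switchTime (hx : ∀ n, x n ∈ G.K) :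
    Tendsto (fun n => C.switchTime x (m n)) atTop atTop :=
  ((strictMono_switchTime hD hx).comp hy.strictMono).tendsto_atTop

theorem tendsto_holdingLength (hx : ∀ n, x n ∈ G.K) :
    Tendsto (fun n => C.holdingLength x (m n)) atTop (𝓝 (C.T q)) := by
  have hs := hy.tendsto_switchTime hD hx
  refine tendsto_iff_dist_tendsto_zero.2 (squeeze_zero' (Eventually.of_forall fun _ => dist_nonneg)
    ?_ (tendsto_one_div_atTop_nhds_zero_nat.comp hs))
  filter_upwards [hs.eventually_gt_atTop 0] with n hn
  exact hy.centre_eq n ▸ abs_rescaledTime_nextSwitch_sub_le hD hn (hy.start_mem n)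

variable (hx : G.IsAdmissible x)
include hx

theorem exists_index_tendsto {t : ℝ} (ht : t ∈ Set.Icc 0 (C.T q)) : ∃ N : ℕ → ℕ,
    (∀ n, C.switchTime x (m n) ≤ N n ∧ N n ≤ C.switchTime x (m n + 1)) ∧
    Tendsto (fun n => rescaledTime (N n) - rescaledTime (C.switchTime x (m n))) atTop (𝓝 t) ∧
    Tendsto (fun n => x (N n)) atTop (𝓝 (y t)) := by
  choose N hsN hNs htime hvalue using fun n =>
    exists_index_near_trajectory (C := C) hD hx (m n) ht.1
  have hsmall : Tendsto (fun n => 1 / ((C.switchTime x (m n) : ℝ) + 1)) atTop (𝓝 0) :=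
    tendsto_one_div_add_atTop_nhds_zero_nat.comp (hy.tendsto_switchTime hD hx.mem)
  have hmin : Tendsto (fun n => min t (C.holdingLength x (m n))) atTop (𝓝 t) := by
    simpa only [min_eq_left ht.2] using
      (tendsto_const_nhds (x := t)).min (hy.tendsto_holdingLength hD hx.mem)
  refine ⟨N, fun n => ⟨hsN n, hNs n⟩, ?_, ?_⟩
  · exact hmin.congr_dist (squeeze_zero (fun _ => dist_nonneg)
      (fun n => (dist_comm _ _).trans_le (htime n)) hsmall)
  · refine (hy.tendsto_trajectory ht.1).congr_dist (squeeze_zero (fun _ => dist_nonneg)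
      (fun n => (dist_comm _ _).trans_le (hvalue n)) ?_)
    simpa only [mul_zero] using hsmall.const_mul (G.vmax.toNNReal : ℝ)

theorem exists_window {s t : ℝ} (hs : s ∈ Set.Icc 0 (C.T q)) (ht : t ∈ Set.Icc 0 (C.T q)) :
    ∃ M N : ℕ → ℕ,
      (∀ n, ∀ i ∈ Finset.Ico (M n) (N n), C.playerStrategy x i = C.strat q) ∧
      Tendsto M atTop atTop ∧ Tendsto N atTop atTop ∧
      Tendsto (fun n => (M n : ℝ) / N n) atTop (𝓝 (Real.exp (-(t - s)))) ∧
      Tendsto (fun n => x (M n)) atTop (𝓝 (y s)) ∧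
      Tendsto (fun n => x (N n)) atTop (𝓝 (y t)) := by
  obtain ⟨M, hM, hMtime, hMvalue⟩ := hy.exists_index_tendsto hD hx hs
  obtain ⟨N, hN, hNtime, hNvalue⟩ := hy.exists_index_tendsto hD hx ht
  have hswitch := hy.tendsto_switchTime hD hx.mem
  have hMtop := tendsto_atTop_mono (fun n => (hM n).1) hswitch
  have hNtop := tendsto_atTop_mono (fun n => (hN n).1) hswitch
  refine ⟨M, N, fun n i hi => ?_, hMtop, hNtop, ?_, hMvalue, hNvalue⟩
  · obtain ⟨hMi, hiN⟩ := Finset.mem_Ico.1 hi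
    rw [playerStrategy_eq hD hx.mem ((hM n).1.trans hMi) (hiN.trans_le (hN n).2)
      (hy.start_mem n).2, hy.centre_eq]
  · refine tendsto_div_of_tendsto_rescaledTime_sub hMtop hNtop ((hNtime.sub hMtime).congr ?_)
    exact fun n => sub_sub_sub_cancel_right _ _ _

theorem dyadicReward_mem_rewardSet [Nonempty Ua] (hG : G.Ergodic) {x₀ : Vec d}
    {θ : ℕ → S} {up : ℕ → Up} {ua : ℕ → Ua} {πa : ℕ → Strategy S Ua}
    (hx_eq : x = average x₀ fun n => G.κ (θ n) (up n) (ua n))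
    (hlaw : ∀ w, Tendsto (fun n : ℕ => (n : ℝ)⁻¹ * ∑ i ∈ Finset.range n,
      (({w} : Set _).indicator 1 (θ i, up i, ua i, θ (i + 1)) -
        G.transitionProb (C.playerStrategy x i) (πa i) (θ i) w)) atTop (𝓝 0))
    {j k : ℕ} (hj : j < 2 ^ k) :
    dyadicReward y (C.T q) j k ∈ G.rewardSet (C.strat q) := by
  set h : ℝ := C.T q / 2 ^ k
  have hT : 0 < C.T q := T_pos (hy.centre_mem hD)
  have hpos : 0 < h := by positivity
  have hlt : Real.exp (-h) < 1 := Real.exp_lt_one_iff.2 (neg_neg_iff_pos.2 hpos)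
  obtain ⟨M, N, hstrat, hM, hN, hratio, hα, hβ⟩ :=
    hy.exists_window hD hx (natCast_mul_div_two_pow_mem_Icc hT.le hj.le)
      (natCast_mul_div_two_pow_mem_Icc hT.le (Nat.succ_le_of_lt hj))
  rw [← sub_mul, Nat.cast_succ, add_sub_cancel_left, one_mul] at hratio
  rw [Nat.cast_succ] at hβ
  refine Game.mem_rewardSet_of_tendsto_window (θ := θ) (up := up) (ua := ua) (πa := πa) hG
    (tendsto_natCast_sub_atTop hN hlt hratio) (fun w => ?_) ?_
  · refine (tendsto_inv_smul_sum_Ico_zero hM hN hlt hratio (hlaw w)).congr fun n => ?_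
    exact congrArg _ (Finset.sum_congr rfl fun i hi => by rw [hstrat n i hi])
  · rw [hx_eq] at hα hβ
    exact tendsto_inv_smul_sum_Ico_of_tendsto_average hN hlt hratio hα hβ

end IsLimitTrajectory

section Play

variable {Ω : Type*} [mΩ : MeasurableSpace Ω] {μ : Measure Ω} [IsFiniteMeasure μ]
  {ℱ : Filtration ℕ mΩ} {x₀ : Vec d} {θ : ℕ → Ω → S} {up : ℕ → Ω → Up} {ua : ℕ → Ω → Ua}
  {πa : ℕ → Ω → Strategy S Ua} (hplay : C.IsPlay μ ℱ x₀ θ up ua πa)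
include hplay

theorem IsPlay.condExp_indicator_ae_eq (n : ℕ) (w : S × Up × Ua × S) :
    μ[((fun ω => (θ n ω, up n ω, ua n ω, θ (n + 1) ω)) ⁻¹' {w}).indicator (fun _ => (1 : ℝ)) | ℱ n]
      =ᵐ[μ] fun ω =>
        G.transitionProb (C.playerStrategy (C.path x₀ θ up ua ω) n) (πa n ω) (θ n ω) w := by
  obtain ⟨s, a, b, s'⟩ := w
  set B := {ω | up n ω = a ∧ ua n ω = b ∧ θ (n + 1) ω = s'}
  have hB : MeasurableSet B := ℱ.le (n + 1) _ ((hplay.player_meas n a).inter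
    ((hplay.adversary_meas n b).inter (hplay.state_meas (n + 1) s')))
  have hinter : (fun ω => (θ n ω, up n ω, ua n ω, θ (n + 1) ω)) ⁻¹' {(s, a, b, s')} =
      {ω | θ n ω = s} ∩ B := by
    ext ω
    simp only [B, Set.mem_preimage, Set.mem_singleton_iff, Prod.mk.injEq, Set.mem_inter_iff,
      Set.mem_ofPred_eq]
  rw [hinter, ← Set.indicator_indicator]
  filter_upwards [condExp_indicator ((integrable_const (1 : ℝ)).indicator hB)
    (hplay.state_meas n s), hplay.step n a b s'] with ω hpull hstep
  rw [hpull, Game.transitionProb]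
  by_cases hs : θ n ω = s
  · rw [Set.indicator_of_mem (s := {ω | θ n ω = s}) hs, hstep, if_pos hs, hs]
  · rw [Set.indicator_of_notMem (s := {ω | θ n ω = s}) hs, if_neg hs]

theorem IsPlay.ae_tendsto_inv_mul_sum_sub_transitionProb :
    ∀ᵐ ω ∂μ, ∀ w, Tendsto (fun n : ℕ => (n : ℝ)⁻¹ * ∑ i ∈ Finset.range n,
      (({w} : Set _).indicator 1 (θ i ω, up i ω, ua i ω, θ (i + 1) ω) -
        G.transitionProb (C.playerStrategy (C.path x₀ θ up ua ω) i) (πa i ω) (θ i ω) w))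
      atTop (𝓝 0) := by
  refine ae_all_iff.2 fun w => ae_tendsto_inv_mul_sum_indicator_sub (ℱ := ℱ)
    (A := fun n => (fun ω => (θ n ω, up n ω, ua n ω, θ (n + 1) ω)) ⁻¹' {w}) (fun n => ?_)
    fun n => hplay.condExp_indicator_ae_eq n w
  have hinter : (fun ω => (θ n ω, up n ω, ua n ω, θ (n + 1) ω)) ⁻¹' {w} =
      {ω | θ n ω = w.1} ∩ ({ω | up n ω = w.2.1} ∩ ({ω | ua n ω = w.2.2.1} ∩
        {ω | θ (n + 1) ω = w.2.2.2})) := by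
    ext ω
    simp only [Set.mem_preimage, Set.mem_singleton_iff, Prod.ext_iff, Set.mem_inter_iff,
      Set.mem_ofPred_eq]
  rw [hinter]
  exact (ℱ.mono n.le_succ _ (hplay.state_meas n _)).inter ((hplay.player_meas n _).inter
    ((hplay.adversary_meas n _).inter (hplay.state_meas (n + 1) _)))

theorem IsPlay.ae_notMem_exceptional [Nonempty Ua] (hD : G.D.Nonempty) (hG : G.Ergodic)
    (hx : ∀ ω, G.IsAdmissible (C.path x₀ θ up ua ω)) :
    ∀ᵐ ω ∂μ, C.path x₀ θ up ua ω ∉ C.exceptional := by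
  filter_upwards [hplay.ae_tendsto_inv_mul_sum_sub_transitionProb] with ω hlaw
  exact notMem_exceptional_iff.2 fun q _ m y hy k j hj => subset_closure
    (hy.dyadicReward_mem_rewardSet hD (hx ω) hG rfl hlaw hj)

end Play

end Scheme

end Trajectories

section Compactness

theorem exists_subseq_tendstoUniformly_of_lipschitzWith {X E : Type*} [PseudoMetricSpace X]
    [CompactSpace X] [MetricSpace E] [ProperSpace E] {K : NNReal} {F : ℕ → X → E}
    (hF : ∀ n, LipschitzWith K (F n)) {x₀ : X}
    (hbdd : Bornology.IsBounded (Set.range fun n => F n x₀)) :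
    ∃ (φ : ℕ → ℕ) (g : X → E), StrictMono φ ∧
      TendstoUniformly (fun n => F (φ n)) g atTop := by
  let F' (n : ℕ) : BoundedContinuousFunction X E := .mkOfCompact ⟨F n, (hF n).continuous⟩
  obtain ⟨r, hr⟩ := hbdd.subset_closedBall (F 0 x₀)
  have hcompact : IsCompact (closure (Set.range F')) := by
    refine BoundedContinuousFunction.arzela_ascoli
      (Metric.closedBall (F 0 x₀) (K * Metric.diam (Set.univ : Set X) + r))
      (isCompact_closedBall _ _) _ ?_ ?_
    · rintro _ x ⟨n, rfl⟩
      refine (dist_triangle _ (F n x₀) _).trans (add_le_add ?_ (hr ⟨n, rfl⟩))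
      refine ((hF n).dist_le_mul x x₀).trans ?_
      gcongr
      exact Metric.dist_le_diam_of_mem isCompact_univ.isBounded trivial trivial
    · refine Metric.equicontinuous_of_continuity_modulus (fun r => K * r) ?_ _ ?_
      · simpa only [mul_zero, id] using (tendsto_id (x := 𝓝 (0 : ℝ))).const_mul (K : ℝ)
      · rintro x x' ⟨_, n, rfl⟩
        exact (hF n).dist_le_mul x x'
  obtain ⟨g, -, φ, hφ, hg⟩ := hcompact.tendsto_subseq fun n => subset_closure ⟨n, rfl⟩
  exact ⟨φ, g, hφ, BoundedContinuousFunction.tendsto_iff_tendstoUniformly.1 hg⟩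

theorem exists_subseq_tendstoUniformlyOn_of_lipschitzOnWith {E : Type*} [MetricSpace E]
    [ProperSpace E] {K : NNReal} {f : ℕ → ℝ → E} {B : ℝ} (hB : 0 ≤ B)
    (hf : ∀ n, LipschitzOnWith K (f n) (Set.Ici 0)) (hfrozen : ∀ n t, B ≤ t → f n t = f n B)
    (hbdd : Bornology.IsBounded (Set.range fun n => f n 0)) :
    ∃ (φ : ℕ → ℕ) (y : ℝ → E), StrictMono φ ∧
      ∀ b : ℝ, TendstoUniformlyOn (fun n => f (φ n)) y atTop (Set.Icc 0 b) := by
  obtain ⟨φ, g, hφ, hg⟩ := exists_subseq_tendstoUniformly_of_lipschitzWith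
    (F := fun n => (Set.Icc 0 B).domRestrict (f n)) (x₀ := ⟨0, le_rfl, hB⟩)
    (fun n => ((hf n).mono Set.Icc_subset_Ici_self).to_restrict) hbdd
  refine ⟨φ, fun t => g (Set.projIcc 0 B hB t), hφ, fun b => ?_⟩
  refine (hg.comp (Set.projIcc 0 B hB)).tendstoUniformlyOn.congr
    (Eventually.of_forall fun n t ht => ?_)
  rcases le_total t B with htB | hBt
  · rw [Function.comp_apply, Set.projIcc_of_mem hB ⟨ht.1, htB⟩, Set.domRestrict_apply]
  · rw [Function.comp_apply, Set.projIcc_of_right_le hB hBt, Set.domRestrict_apply,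
      hfrozen _ _ hBt]

end Compactness

section Descent

theorem norm_add_smul_sub_sub_sq_le {F : Type*} [NormedAddCommGroup F] [InnerProductSpace ℝ F]
    {z r c : F} {ε α : ℝ} (hα : 0 ≤ α) (hε : ε ≤ inner ℝ (r - c) (c - z)) :
    ‖z + α • (r - z) - c‖ ^ 2 ≤ ‖z - c‖ ^ 2 - 2 * (α * ε) + ‖α • (r - z)‖ ^ 2 := by
  have hinner : ε ≤ -inner ℝ (z - c) (r - z) := by
    rw [← inner_neg_left, neg_sub, ← sub_add_sub_cancel r c z, inner_add_right,
      real_inner_comm (r - c)]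
    exact le_add_of_le_of_nonneg hε real_inner_self_nonneg
  rw [add_sub_right_comm, norm_add_sq_real, real_inner_smul_right]
  linarith [mul_le_mul_of_nonneg_left hinner hα]

theorem sub_sq_le_one_sub_exp_neg {h : ℝ} (hh : 0 ≤ h) : h - h ^ 2 ≤ 1 - Real.exp (-h) := by
  have hexp : Real.exp (-h) * (h + 1) ≤ 1 := by
    calc Real.exp (-h) * (h + 1) ≤ Real.exp (-h) * Real.exp h := by
          gcongr
          exact Real.add_one_le_exp h
      _ = 1 := by rw [← Real.exp_add, neg_add_cancel, Real.exp_zero]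
  nlinarith [Real.exp_pos (-h), pow_nonneg hh 3]

theorem add_smul_dyadicReward_sub {d : ℕ} (y : ℝ → Vec d) {T : ℝ} (hT : 0 < T) (j k : ℕ) :
    y (j * (T / 2 ^ k)) + (1 - Real.exp (-(T / 2 ^ k))) •
      (Scheme.dyadicReward y T j k - y (j * (T / 2 ^ k))) = y ((j + 1 : ℕ) * (T / 2 ^ k)) := by
  have hlt : Real.exp (-(T / 2 ^ k)) < 1 :=
    Real.exp_lt_one_iff.2 (neg_neg_iff_pos.2 (by positivity))
  rw [Scheme.dyadicReward, smul_sub, smul_inv_smul₀ (sub_pos.2 hlt).ne', Nat.cast_succ]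
  module

variable {S Up Ua : Type*} [Fintype S] {d : ℕ} {G : Game S Up Ua d}

theorem Game.infDist_add_smul_sub_sq_le (hD : G.D.Nonempty) {z r : Vec d} {ε α : ℝ} (hα : 0 ≤ α)
    (hε : ε ≤ inner ℝ (r - G.proj z) (G.proj z - z)) :
    Metric.infDist (z + α • (r - z)) G.D ^ 2 ≤
      Metric.infDist z G.D ^ 2 - 2 * (α * ε) + ‖α • (r - z)‖ ^ 2 := by
  refine le_trans ?_ ((norm_add_smul_sub_sub_sq_le hα hε).trans_eq (by rw [norm_sub_proj hD]))
  rw [← Metric.infDist_closure, ← dist_eq_norm]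
  gcongr
  exacts [Metric.infDist_nonneg, Metric.infDist_le_dist_of_mem (proj_spec hD z).1]

variable {y : ℝ → Vec d} {T ε : ℝ} {V : NNReal}

theorem infDist_sq_le_sub_of_dyadicReward (hD : G.D.Nonempty) (hT : 0 < T) (hε : 0 ≤ ε)
    (hy : LipschitzOnWith V y (Set.Ici 0)) {k : ℕ}
    (hsep : ∀ j < 2 ^ k, ∀ t ∈ Set.Icc 0 T,
      ε ≤ inner ℝ (Scheme.dyadicReward y T j k - G.proj (y t)) (G.proj (y t) - y t)) :
    Metric.infDist (y T) G.D ^ 2 ≤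
      Metric.infDist (y 0) G.D ^ 2 - (2 * (ε * T) - (2 * ε + V ^ 2) * T ^ 2 / 2 ^ k) := by
  set h : ℝ := T / 2 ^ k with hh
  have hpos : 0 < h := by positivity
  have hα := sub_sq_le_one_sub_exp_neg hpos.le
  have hexp : Real.exp (-h) ≤ 1 := Real.exp_le_one_iff.2 (neg_nonpos.2 hpos.le)
  have hstep : ∀ j : ℕ, j < 2 ^ k → Metric.infDist (y ((j + 1 : ℕ) * h)) G.D ^ 2 -
      Metric.infDist (y (j * h)) G.D ^ 2 ≤ -(2 * ε * (h - h ^ 2) - (V * h) ^ 2) := fun j hj => by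
    have hdist : ‖(1 - Real.exp (-h)) • (Scheme.dyadicReward y T j k - y (j * h))‖ ≤ V * h := by
      rw [← add_sub_cancel_left (y (j * h)) (_ • _), add_smul_dyadicReward_sub y hT,
        ← dist_eq_norm]
      refine (hy.dist_le_mul _ (Set.mem_Ici.2 (by positivity)) _
        (Set.mem_Ici.2 (by positivity))).trans_eq ?_
      rw [Real.dist_eq, ← sub_mul, Nat.cast_succ, add_sub_cancel_left, one_mul, abs_of_pos hpos]
    have hdescent := Game.infDist_add_smul_sub_sq_le hD (sub_nonneg.2 hexp)
      (hsep j hj _ (natCast_mul_div_two_pow_mem_Icc hT.le hj.le))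
    rw [add_smul_dyadicReward_sub y hT] at hdescent
    linarith [pow_le_pow_left₀ (norm_nonneg _) hdist 2, mul_le_mul_of_nonneg_right hα hε]
  have hsum := Finset.sum_le_card_nsmul (Finset.range (2 ^ k)) _ _
    fun j hj => hstep j (Finset.mem_range.1 hj)
  rw [Finset.sum_range_sub fun j : ℕ => Metric.infDist (y (j * h)) G.D ^ 2, Finset.card_range,
    nsmul_eq_mul, Nat.cast_pow, Nat.cast_ofNat, Nat.cast_zero, zero_mul, hh,
    mul_div_cancel₀ _ (by positivity)] at hsum
  refine (sub_le_iff_le_add'.1 hsum).trans_eq ?_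
  field_simp
  ring

theorem infDist_sq_le_of_dyadicReward (hD : G.D.Nonempty) (hT : 0 < T) (hε : 0 ≤ ε)
    (hy : LipschitzOnWith V y (Set.Ici 0))
    (hsep : ∀ k, ∀ j < 2 ^ k, ∀ t ∈ Set.Icc 0 T,
      ε ≤ inner ℝ (Scheme.dyadicReward y T j k - G.proj (y t)) (G.proj (y t) - y t)) :
    Metric.infDist (y T) G.D ^ 2 ≤ Metric.infDist (y 0) G.D ^ 2 - 2 * (ε * T) := by
  have herror : Tendsto (fun k : ℕ => (2 * ε + V ^ 2) * T ^ 2 / 2 ^ k) atTop (𝓝 0) :=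
    tendsto_const_nhds.div_atTop (tendsto_pow_atTop_atTop_of_one_lt one_lt_two)
  refine ge_of_tendsto' (x := atTop) (f := fun k : ℕ => Metric.infDist (y 0) G.D ^ 2 -
    (2 * (ε * T) - (2 * ε + V ^ 2) * T ^ 2 / 2 ^ k)) ?_ fun k => ?_
  · simpa only [sub_zero] using (herror.const_sub (2 * (ε * T))).const_sub _
  · exact infDist_sq_le_sub_of_dyadicReward hD hT hε hy (hsep k)

end Descent

section Drop

variable {f : ℕ → ℝ} (hf : ∀ n, 0 ≤ f n)
include hf

theorem frequently_lt_of_eventually_le_sub {c δ : ℝ} (hδ : 0 < δ)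
    (hdrop : ∀ᶠ n in atTop, c ≤ f n → f (n + 1) ≤ f n - δ) : ∃ᶠ n in atTop, f n < c := by
  intro hlarge
  obtain ⟨m, hm⟩ := eventually_atTop.1 (hdrop.and hlarge)
  have hlinear (k : ℕ) : f (m + k) ≤ f m - k * δ := by
    induction k with
    | zero => simp
    | succ k ih =>
      obtain ⟨hstep, hc⟩ := hm (m + k) (Nat.le_add_right m k)
      rw [Nat.cast_succ, ← add_assoc]
      linarith [hstep (not_lt.1 hc)]
  obtain ⟨k, hk⟩ := exists_nat_gt (f m / δ)
  rw [div_lt_iff₀ hδ] at hk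
  linarith [hf (m + k), hlinear k]

theorem tendsto_zero_of_eventually_le_sub
    (hdrop : ∀ c > 0, ∃ δ > 0, ∀ᶠ n in atTop, c ≤ f n → f (n + 1) ≤ f n - δ)
    (hgrowth : ∀ η > 0, ∃ c > 0, ∀ᶠ n in atTop, f n < c → f (n + 1) < η) :
    Tendsto f atTop (𝓝 0) := by
  refine tendsto_order.2 ⟨fun a ha => Eventually.of_forall fun n => ha.trans_le (hf n),
    fun η hη => ?_⟩
  obtain ⟨c, hc, hsmall⟩ := hgrowth η hη
  obtain ⟨δ, hδ, hdrop⟩ := hdrop (min c η) (lt_min hc hη)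
  obtain ⟨N, hN⟩ := eventually_atTop.1 (hsmall.and hdrop)
  obtain ⟨m, hNm, hm⟩ :=
    frequently_atTop.1 (frequently_lt_of_eventually_le_sub hf hδ hdrop) N
  filter_upwards [eventually_ge_atTop m] with n hn
  induction n, hn using Nat.le_induction with
  | base => exact hm.trans_le (min_le_right _ _)
  | succ n hn ih =>
    obtain ⟨hsmall, hdrop⟩ := hN n (hNm.trans hn)
    rcases lt_or_ge (f n) c with hlt | hge
    · exact hsmall hlt
    · linarith [hdrop ((min_le_left _ _).trans hge)]

end Drop

section Approachability

variable {S Up Ua : Type*} [Fintype S] [Fintype Up] [Fintype Ua] {d : ℕ} {G : Game S Up Ua d}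

namespace Scheme

variable {C : Scheme G} {x : ℕ → Vec d} (hD : G.D.Nonempty) (hx : G.IsAdmissible x)
include hD hx

theorem exists_isLimitTrajectory (hK : Bornology.IsBounded G.K) {q : Vec d} {m : ℕ → ℕ}
    (hm : StrictMono m) (hstart : ∀ n, x (C.switchTime x (m n)) ∈ G.K \ closure G.D)
    (hq : ∀ n, C.Q (x (C.switchTime x (m n))) = q) :
    ∃ φ : ℕ → ℕ, StrictMono φ ∧ ∃ y, C.IsLimitTrajectory x q (m ∘ φ) y := by
  have hT : 0 < C.T q := T_pos (hq 0 ▸ (Q_spec hD (hstart 0)).1)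
  have hlength (n : ℕ) : C.holdingLength x (m (n + 1)) ≤ C.T q + 1 := by
    have hs : 0 < C.switchTime x (m (n + 1)) :=
      (n.zero_lt_succ.trans_le (hm.id_le _)).trans_le ((strictMono_switchTime hD hx.mem).id_le _)
    have habs :=
      (abs_le.1 (abs_rescaledTime_nextSwitch_sub_le (C := C) hD hs (hstart (n + 1)))).2
    rw [hq] at habs
    have hone : 1 / (C.switchTime x (m (n + 1)) : ℝ) ≤ 1 :=
      (div_le_one (Nat.cast_pos.2 hs)).2 (Nat.one_le_cast.2 hs)
    exact sub_le_iff_le_add'.1 (habs.trans hone)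
  obtain ⟨φ, y, hφ, hy⟩ := exists_subseq_tendstoUniformlyOn_of_lipschitzOnWith (B := C.T q + 1)
    (f := fun n => C.trajectory x (m (n + 1))) (by positivity)
    (fun n => lipschitzOnWith_trajectory hD hx (m (n + 1)))
    (fun n t ht => by
      rw [trajectory_of_holdingLength_le ((hlength n).trans ht),
        trajectory_of_holdingLength_le (hlength n)])
    (hK.subset (Set.range_subset_iff.2 fun n =>
      (trajectory_zero hD hx.mem _).symm ▸ hx.mem _))
  have hφ' : StrictMono fun n => φ n + 1 := fun a b hab => Nat.succ_lt_succ (hφ hab)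
  exact ⟨fun n => φ n + 1, hφ', y, hm.comp hφ', fun n => hstart _, fun n => hq _, hy⟩

namespace IsLimitTrajectory

variable {q : Vec d} {m : ℕ → ℕ} {y : ℝ → Vec d} (hy : C.IsLimitTrajectory x q m y)
include hy

theorem lipschitzOnWith : LipschitzOnWith G.vmax.toNNReal y (Set.Ici 0) :=
  LipschitzOnWith.of_dist_le_mul fun _ hs _ ht =>
    le_of_tendsto' ((hy.tendsto_trajectory hs).dist (hy.tendsto_trajectory ht)) fun n =>
      (lipschitzOnWith_trajectory hD hx (m n)).dist_le_mul _ hs _ ht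

theorem tendsto_start : Tendsto (fun n => x (C.switchTime x (m n))) atTop (𝓝 (y 0)) := by
  simpa only [trajectory_zero hD hx.mem] using hy.tendsto_trajectory le_rfl

theorem tendsto_end : Tendsto (fun n => x (C.switchTime x (m n + 1))) atTop (𝓝 (y (C.T q))) := by
  have hT : 0 ≤ C.T q := (T_pos (hy.centre_mem hD)).le
  have hlength := (tendsto_iff_dist_tendsto_zero.1 (hy.tendsto_holdingLength hD hx.mem)).const_mul
    (G.vmax.toNNReal : ℝ)
  rw [mul_zero] at hlength
  refine (hy.tendsto_trajectory hT).congr_dist (squeeze_zero (fun _ => dist_nonneg) (fun n => ?_)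
    hlength)
  rw [dist_comm, ← trajectory_of_holdingLength_le (C := C) (x := x) (m := m n) le_rfl]
  exact (lipschitzOnWith_trajectory hD hx (m n)).dist_le_mul _ (holdingLength_pos hD hx.mem _).le
    _ hT

theorem mem_ball {t : ℝ} (ht : t ∈ Set.Icc 0 (C.T q)) : y t ∈ Metric.ball q (C.ρ q) := by
  have hq := hy.centre_mem hD
  have hstart : dist (y 0) q ≤ C.ρ q / 2 :=
    le_of_tendsto' ((hy.tendsto_start hD hx).dist tendsto_const_nhds) fun n =>
      (hy.centre_eq n ▸ (C.Q_spec hD (hy.start_mem n)).2.1).le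
  have hmove : dist (y t) (y 0) ≤ G.vmax * C.T q := by
    refine ((hy.lipschitzOnWith hD hx).dist_le_mul _ ht.1 _ Set.self_mem_Ici).trans ?_
    rw [Real.coe_toNNReal _ hx.vmax_nonneg, Real.dist_0_eq_abs, abs_of_nonneg ht.1]
    exact mul_le_mul_of_nonneg_left ht.2 hx.vmax_nonneg
  have hρ := C.ρ_pos q (C.centres_subset hq)
  exact (dist_triangle (y t) (y 0) q).trans_lt (by linarith [vmax_mul_T_lt hq])

theorem infDist_sq_le (hN : x ∉ C.exceptional) {ε : ℝ} (hε : 0 ≤ ε)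
    (hsep : ∀ z ∈ Metric.ball q (C.ρ q), ∀ πa : Strategy S Ua,
      ε ≤ inner ℝ (G.meanReward (C.strat q) πa - G.proj z) (G.proj z - z)) :
    Metric.infDist (y (C.T q)) G.D ^ 2 ≤ Metric.infDist (y 0) G.D ^ 2 - 2 * (ε * C.T q) := by
  have hq := hy.centre_mem hD
  refine infDist_sq_le_of_dyadicReward hD (T_pos hq) hε (hy.lipschitzOnWith hD hx)
    fun k j hj t ht => ?_
  have hclosed : IsClosed {r : Vec d | ε ≤ inner ℝ (r - G.proj (y t)) (G.proj (y t) - y t)} :=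
    isClosed_le continuous_const (by fun_prop)
  exact hclosed.closure_subset_iff.2 (Set.range_subset_iff.2 (hsep _ (hy.mem_ball hD hx ht)))
    (notMem_exceptional_iff.1 hN q hq m y hy k j hj)

end IsLimitTrajectory

theorem eventually_infDist_sq_le_of_Q_eq (hK : Bornology.IsBounded G.K) (hN : x ∉ C.exceptional)
    {q : Vec d} (hq : q ∈ C.centres) :
    ∃ δ > 0, ∀ᶠ m in atTop, x (C.switchTime x m) ∈ G.K \ closure G.D →
      C.Q (x (C.switchTime x m)) = q →
      Metric.infDist (x (C.switchTime x (m + 1))) G.D ^ 2 ≤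
        Metric.infDist (x (C.switchTime x m)) G.D ^ 2 - δ := by
  obtain ⟨ε, hε, hsep⟩ := C.separates q (C.centres_subset hq)
  have hδ : 0 < ε * C.T q := mul_pos hε (T_pos hq)
  refine ⟨ε * C.T q, hδ, ?_⟩
  by_contra hfreq
  obtain ⟨m, hm, hbad⟩ := extraction_of_frequently_atTop (not_eventually.1 hfreq)
  simp only [Classical.not_imp, not_le] at hbad
  obtain ⟨φ, -, y, hy⟩ := exists_isLimitTrajectory hD hx hK hm (fun n => (hbad n).1)
    fun n => (hbad n).2.1
  have hcont : Continuous fun z : Vec d => Metric.infDist z G.D ^ 2 :=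
    (Metric.continuous_infDist_pt G.D).pow 2
  have hlim := le_of_tendsto_of_tendsto'
    (((hcont.tendsto _).comp (hy.tendsto_start hD hx)).sub_const (ε * C.T q))
    ((hcont.tendsto _).comp (hy.tendsto_end hD hx)) fun n => (hbad (φ n)).2.2.le
  linarith [hy.infDist_sq_le hD hx hN hε.le hsep]

theorem eventually_infDist_sq_le (hK : Bornology.IsBounded G.K) (hN : x ∉ C.exceptional) {c : ℝ}
    (hc : 0 < c) :
    ∃ δ > 0, ∀ᶠ m in atTop, c ≤ Metric.infDist (x (C.switchTime x m)) G.D →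
      Metric.infDist (x (C.switchTime x (m + 1))) G.D ^ 2 ≤
        Metric.infDist (x (C.switchTime x m)) G.D ^ 2 - δ := by
  have hmem {z : Vec d} (hz : z ∈ {z ∈ G.K | c ≤ Metric.infDist z G.D}) : z ∈ G.K \ closure G.D :=
    ⟨hz.1, Game.notMem_closure_of_infDist_pos (hc.trans_le hz.2)⟩
  have hfin := C.finite_image_Q hD hc
  choose! δ hδ hdrop using fun q (hq : q ∈ C.Q '' {z ∈ G.K | c ≤ Metric.infDist z G.D}) =>
    eventually_infDist_sq_le_of_Q_eq hD hx hK hN (q := q) <| by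
      obtain ⟨z, hz, rfl⟩ := hq
      exact (Q_spec hD (hmem hz)).1
  obtain ⟨δ₀, hle, hpos⟩ := (((eventually_all_finite hfin).2 fun q hq =>
    nhdsWithin_le_nhds (ge_mem_nhds (hδ q hq))).and (self_mem_nhdsWithin (s := Set.Ioi 0))).exists
  refine ⟨δ₀, hpos, ?_⟩
  filter_upwards [(eventually_all_finite hfin).2 hdrop] with m hm hcm
  have hz : x (C.switchTime x m) ∈ {z ∈ G.K | c ≤ Metric.infDist z G.D} := ⟨hx.mem _, hcm⟩
  exact (hm _ ⟨_, hz, rfl⟩ (hmem hz) rfl).trans (sub_le_sub_left (hle _ ⟨_, hz, rfl⟩) _)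

theorem infDist_le_of_mem_period [Nonempty Ua] {m n : ℕ} (hs : 0 < C.switchTime x m)
    (hmn : C.switchTime x m ≤ n) (hnm : n ≤ C.switchTime x (m + 1)) :
    Metric.infDist (x n) G.D ≤ 5 / 3 * Metric.infDist (x (C.switchTime x m)) G.D +
      G.vmax * (1 / (C.switchTime x m : ℝ)) := by
  have hswitch : C.switchTime x (m + 1) = C.nextSwitch x (C.switchTime x m) := rfl
  set s := C.switchTime x m
  have hv := hx.vmax_nonneg
  have hmove : dist (x n) (x s) ≤
      G.vmax * (rescaledTime (C.nextSwitch x s) - rescaledTime s) := by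
    rw [dist_comm]
    refine (dist_le_mul_rescaledTime_sub hx.dist_le hmn).trans ?_
    gcongr
    exact rescaledTime_strictMono.monotone (hnm.trans_eq hswitch)
  have hclose : Metric.infDist (x n) G.D ≤ Metric.infDist (x s) G.D + dist (x n) (x s) :=
    Metric.infDist_le_infDist_add_dist
  have hnonneg : 0 ≤ Metric.infDist (x s) G.D := Metric.infDist_nonneg
  by_cases hsD : x s ∈ closure G.D
  · rw [nextSwitch, if_pos hsD, rescaledTime_succ, add_sub_cancel_left] at hmove
    have hanti : G.vmax * (1 / ((s : ℝ) + 1)) ≤ G.vmax * (1 / (s : ℝ)) := by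
      gcongr
      exact le_add_of_nonneg_right zero_le_one
    linarith
  · obtain ⟨hq, hball, -⟩ := C.Q_spec hD ⟨hx.mem s, hsD⟩
    have htime := sub_le_iff_le_add'.1 (abs_le.1
      (abs_rescaledTime_nextSwitch_sub_le (C := C) hD hs ⟨hx.mem s, hsD⟩)).2
    have hlength := mul_le_mul_of_nonneg_left htime hv
    have hcentre : Metric.infDist (C.Q (x s)) G.D ≤
        Metric.infDist (x s) G.D + dist (C.Q (x s)) (x s) := Metric.infDist_le_infDist_add_dist
    linarith [vmax_mul_T_lt hq, ρ_le_infDist hD hq, Metric.mem_ball'.1 hball]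

theorem tendsto_mul_one_div_switchTime :
    Tendsto (fun m => G.vmax * (1 / (C.switchTime x m : ℝ))) atTop (𝓝 0) := by
  simpa only [mul_zero, Function.comp_def] using (tendsto_one_div_atTop_nhds_zero_nat.comp
    (strictMono_switchTime (C := C) hD hx.mem).tendsto_atTop).const_mul G.vmax

variable [Nonempty Ua]

theorem tendsto_infDist_switchTime (hK : Bornology.IsBounded G.K) (hN : x ∉ C.exceptional) :
    Tendsto (fun m => Metric.infDist (x (C.switchTime x m)) G.D) atTop (𝓝 0) := by
  suffices hsq : Tendsto (fun m => Metric.infDist (x (C.switchTime x m)) G.D ^ 2) atTop (𝓝 0) by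
    simpa only [Real.sqrt_sq Metric.infDist_nonneg, Real.sqrt_zero] using hsq.sqrt
  refine tendsto_zero_of_eventually_le_sub (fun m => sq_nonneg _) (fun c hc => ?_) fun η hη => ?_
  · obtain ⟨δ, hδ, hdrop⟩ := eventually_infDist_sq_le hD hx hK hN (Real.sqrt_pos.2 hc)
    refine ⟨δ, hδ, hdrop.mono fun m hm hcm => hm ?_⟩
    exact Real.sqrt_le_left Metric.infDist_nonneg |>.2 hcm
  · have hη' := Real.sqrt_pos.2 hη
    refine ⟨(√η / 4) ^ 2, by positivity, ?_⟩
    filter_upwards [(tendsto_mul_one_div_switchTime (C := C) hD hx).eventually_lt_const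
      (by positivity : 0 < √η / 4), eventually_gt_atTop 0] with m herror hm hsmall
    have hgrowth := infDist_le_of_mem_period hD hx
      (hm.trans_le ((strictMono_switchTime hD hx.mem).id_le m))
      (strictMono_switchTime (C := C) hD hx.mem m.lt_succ_self).le le_rfl
    rw [← Real.lt_sqrt Metric.infDist_nonneg]
    linarith [(sq_lt_sq₀ Metric.infDist_nonneg (by positivity)).1 hsmall]

theorem tendsto_infDist (hK : Bornology.IsBounded G.K) (hN : x ∉ C.exceptional) :
    Tendsto (fun n => Metric.infDist (x n) G.D) atTop (𝓝 0) := by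
  have hmono := strictMono_switchTime (C := C) hD hx.mem
  choose p hp hp' using fun n : ℕ => exists_le_lt_succ (f := C.switchTime x) n.zero_le
    ⟨n + 1, n.lt_succ_self.trans_le (hmono.id_le _)⟩
  have hp_top : Tendsto p atTop atTop := tendsto_atTop.2 fun b => by
    filter_upwards [eventually_ge_atTop (C.switchTime x b)] with n hn
    exact Nat.lt_succ_iff.1 (hmono.lt_iff_lt.1 (hn.trans_lt (hp' n)))
  have hbound : Tendsto (fun m => 5 / 3 * Metric.infDist (x (C.switchTime x m)) G.D +
      G.vmax * (1 / (C.switchTime x m : ℝ))) atTop (𝓝 0) := by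
    simpa only [mul_zero, add_zero] using ((tendsto_infDist_switchTime hD hx hK hN).const_mul
      (5 / 3)).add (tendsto_mul_one_div_switchTime hD hx)
  refine squeeze_zero' (Eventually.of_forall fun _ => Metric.infDist_nonneg) ?_
    (hbound.comp hp_top)
  filter_upwards [hp_top.eventually_gt_atTop 0] with n hn
  exact infDist_le_of_mem_period hD hx (hn.trans_le (hmono.id_le _)) (hp n) (hp' n).le

theorem mem_closure_of_mapClusterPt (hK : Bornology.IsBounded G.K) (hN : x ∉ C.exceptional)
    {z : Vec d} (hz : MapClusterPt z atTop x) : z ∈ closure G.D := by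
  obtain ⟨φ, hφ, hzφ⟩ := hz.tendsto_subseq
  have hlim := ((Metric.continuous_infDist_pt G.D).tendsto z).comp hzφ
  refine (Metric.mem_closure_iff_infDist_zero hD).2 (tendsto_nhds_unique hlim ?_)
  exact (tendsto_infDist hD hx hK hN).comp hφ.tendsto_atTop

end Scheme

end Approachability

section Existence

variable {S Up Ua : Type*} [Fintype S] {d : ℕ} {G : Game S Up Ua d}

namespace Game

theorem inner_sub_proj_nonpos (hD : G.D.Nonempty) (hconv : Convex ℝ (closure G.D)) (x : Vec d)
    {z : Vec d} (hz : z ∈ closure G.D) : inner ℝ (x - G.proj x) (z - G.proj x) ≤ 0 := by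
  obtain ⟨hmem, hmin⟩ := proj_spec hD x
  have : Nonempty (closure G.D) := hD.closure.to_subtype
  have hbdd : BddBelow (Set.range fun w : closure G.D => ‖x - w‖) :=
    ⟨0, Set.forall_mem_range.2 fun _ => norm_nonneg _⟩
  exact (norm_eq_iInf_iff_real_inner_le_zero hconv hmem).1
    (le_antisymm (le_ciInf fun w => hmin w w.2) (ciInf_le hbdd ⟨_, hmem⟩)) z hz

theorem lipschitzWith_proj (hD : G.D.Nonempty) (hconv : Convex ℝ (closure G.D)) :
    LipschitzWith 1 G.proj := by
  refine LipschitzWith.of_dist_le_mul fun x y => ?_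
  rw [NNReal.coe_one, one_mul, dist_eq_norm, dist_eq_norm]
  have hx := inner_sub_proj_nonpos hD hconv x (proj_spec hD y).1
  have hy := inner_sub_proj_nonpos hD hconv y (proj_spec hD x).1
  have hinner : ‖G.proj x - G.proj y‖ ^ 2 ≤ inner ℝ (x - y) (G.proj x - G.proj y) := by
    have hsplit : x - y = (x - G.proj x) + (G.proj x - G.proj y) - (y - G.proj y) := by abel
    rw [← neg_sub (G.proj x) (G.proj y), inner_neg_right] at hx
    rw [hsplit, inner_sub_left, inner_add_left, real_inner_self_eq_norm_sq]
    linarith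
  rcases (norm_nonneg (G.proj x - G.proj y)).eq_or_lt with hzero | hpos
  · exact hzero ▸ norm_nonneg _
  · refine le_of_mul_le_mul_right ?_ hpos
    exact (pow_two _).symm.trans_le (hinner.trans (real_inner_le_norm _ _))

theorem isCompact_layer (hK : IsCompact G.K) (n : ℕ) : IsCompact (G.layer n) := by
  have hcont : Continuous fun y => Metric.infDist y G.D := Metric.continuous_infDist_pt _
  have hlower : IsClosed {y : Vec d | 1 / ((n : ℝ) + 1) ≤ Metric.infDist y G.D} :=
    isClosed_le continuous_const hcont
  have hupper : IsClosed {y : Vec d | n ≠ 0 → Metric.infDist y G.D ≤ 1 / (n : ℝ)} :=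
    isClosed_imp isOpen_const (isClosed_le hcont continuous_const)
  exact hK.inter_right (hlower.inter hupper)

variable [Fintype Up] [Fintype Ua] [Nonempty S]

theorem exists_ball_separates (hD : G.D.Nonempty) (hconv : Convex ℝ (closure G.D)) {x : Vec d}
    {πp : Strategy S Up} {ε : ℝ} (hε : 0 < ε)
    (hx : ∀ πa : Strategy S Ua, ε ≤ inner ℝ (G.meanReward πp πa - G.proj x) (G.proj x - x)) :
    ∃ ρ > 0, ∃ ε > 0, ∀ y ∈ Metric.ball x ρ, ∀ πa : Strategy S Ua,
      ε ≤ inner ℝ (G.meanReward πp πa - G.proj y) (G.proj y - y) := by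
  have hproj := (lipschitzWith_proj hD hconv).continuous
  have hcompact : IsCompact (closure (G.rewardSet (Ua := Ua) πp)) :=
    (isBounded_rewardSet πp).isCompact_closure
  have hcont : Continuous fun z : Vec d × Vec d =>
      inner ℝ (z.2 - G.proj z.1) (G.proj z.1 - z.1) := by fun_prop
  have hclosure : closure (G.rewardSet (Ua := Ua) πp) ⊆
      {r | ε ≤ inner ℝ (r - G.proj x) (G.proj x - x)} :=
    closure_minimal (Set.range_subset_iff.2 hx) (isClosed_le continuous_const (by fun_prop))
  have hnear : ∀ᶠ y in 𝓝 x, ∀ r ∈ closure (G.rewardSet (Ua := Ua) πp),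
      ε / 2 ≤ inner ℝ (r - G.proj y) (G.proj y - y) :=
    hcompact.eventually_forall_of_forall_eventually fun r hr =>
      hcont.continuousAt.eventually_const_le ((half_lt_self hε).trans_le (hclosure hr))
  obtain ⟨ρ, hρ, hball⟩ := Metric.eventually_nhds_iff_ball.1 hnear
  exact ⟨ρ, hρ, ε / 2, half_pos hε, fun y hy πa => hball y hy _ (subset_closure ⟨πa, rfl⟩)⟩

-- If `vmax = 0`, all rewards, and so all mean rewards, equal `x`.
theorem Separation.vmax_pos [Nonempty Ua] (hsep : G.Separation) (hK : Bornology.IsBounded G.K)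
    {x : Vec d} (hx : x ∈ G.K \ closure G.D) : 0 < G.vmax := by
  obtain ⟨πp, ε, hε, hle⟩ := hsep x hx
  let πa : Strategy S Ua := Classical.arbitrary _
  by_contra! hv
  have hrewards : {r | ∃ θ a b, r = G.κ θ a b} ⊆ {x} := by
    rintro _ ⟨θ, a, b, rfl⟩
    exact sub_eq_zero.1 (norm_le_zero_iff.1 ((norm_sub_le_vmax hK hx.1 θ a b).trans hv))
  have hmean : G.meanReward πp πa = x :=
    convexHull_min hrewards (convex_singleton x) (meanReward_mem_convexHull πp πa)
  have hinner := hle πa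
  rw [hmean, ← neg_sub, inner_neg_left, real_inner_self_eq_norm_sq] at hinner
  linarith [sq_nonneg ‖G.proj x - x‖]

end Game

theorem Scheme.nonempty_of_separation [Fintype Up] [Fintype Ua] [Nonempty S] [Nonempty Up]
    [Nonempty Ua] (hK : IsCompact G.K) (hD : G.D.Nonempty) (hconv : Convex ℝ (closure G.D))
    (hsep : G.Separation) : Nonempty (Scheme G) := by
  have hball : ∀ x ∈ G.K \ closure G.D, ∃ πp : Strategy S Up, ∃ ρ > 0, ∃ ε > 0,
      ∀ y ∈ Metric.ball x ρ, ∀ πa : Strategy S Ua,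
        ε ≤ inner ℝ (G.meanReward πp πa - G.proj y) (G.proj y - y) := fun x hx =>
    let ⟨πp, _, hε, hle⟩ := hsep x hx
    ⟨πp, Game.exists_ball_separates hD hconv hε hle⟩
  choose! strat ρ hρ hstrat using hball
  have hcover (n : ℕ) : ∃ t : Finset (Vec d), (∀ q ∈ t, q ∈ G.layer n) ∧
      G.layer n ⊆ ⋃ q ∈ t, Metric.ball q (ρ q / 2) :=
    (Game.isCompact_layer hK n).elim_nhds_subcover (fun q => Metric.ball q (ρ q / 2)) fun q hq =>
      Metric.ball_mem_nhds q (half_pos (hρ q (Game.layer_subset n hq)))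
  choose net hnet hcover using hcover
  obtain ⟨index, hindex⟩ := Set.countable_iff_exists_injOn.1
    (Set.countable_iUnion fun n => (net n).countable_toSet)
  have hpos : ∀ q ∈ ⋃ n, (net n : Set (Vec d)), 0 < ρ q / G.vmax := fun q hq => by
    obtain ⟨n, hn⟩ := Set.mem_iUnion.1 hq
    have hqK := Game.layer_subset n (hnet n q hn)
    exact div_pos (hρ q hqK) (hsep.vmax_pos hK.isBounded hqK)
  exact ⟨{
    strat := strat
    strat₀ := Classical.arbitrary _
    ρ := ρ
    ρ_pos := hρ
    separates := hstrat
    net := net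
    net_subset := hnet
    net_covers := hcover
    index := index
    index_injOn := hindex
    T := fun q => 7 / 24 * (ρ q / G.vmax)
    T_bounds := fun q hq => by
      rw [div_mul_eq_div_div_swap, div_mul_eq_div_div_swap]
      constructor <;> linarith [hpos q hq] }⟩

end Existence

end Approach

end

theorem mainTheorem1_general {S Up Ua : Type*} [Fintype S] [Fintype Up] [Fintype Ua]
    [Nonempty S] [Nonempty Up] [Nonempty Ua] {d : ℕ} (G : Approach.Game S Up Ua d)
    (hK : IsCompact G.K)
    (hκ : convexHull ℝ {r | ∃ θ a b, r = G.κ θ a b} ⊆ G.K)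
    (hD : G.D.Nonempty) (hconv : Convex ℝ (closure G.D))
    (hergodic : G.Ergodic) (hsep : G.Separation) :
    Nonempty (Approach.Scheme G) ∧
    ∀ (C : Approach.Scheme G) {Ω : Type*} [mΩ : MeasurableSpace Ω]
      (μ : Measure Ω) [IsFiniteMeasure μ] (ℱ : Filtration ℕ mΩ)
      (x₀ : Approach.Vec d) (θ : ℕ → Ω → S) (up : ℕ → Ω → Up) (ua : ℕ → Ω → Ua)
      (πa : ℕ → Ω → Approach.Strategy S Ua),
      x₀ ∈ G.K → C.IsPlay μ ℱ x₀ θ up ua πa →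
        (∀ᵐ ω ∂μ, C.path x₀ θ up ua ω ∉ C.exceptional) ∧
        (∀ ω, C.path x₀ θ up ua ω ∉ C.exceptional →
          ∀ x, MapClusterPt x atTop (C.path x₀ θ up ua ω) → x ∈ closure G.D) := by
  refine ⟨Approach.Scheme.nonempty_of_separation hK hD hconv hsep, ?_⟩
  intro C Ω _ μ _ ℱ x₀ θ up ua πa hx₀ hplay
  have hx := C.isAdmissible_path hK.isBounded hκ hx₀ θ up ua
  exact ⟨hplay.ae_notMem_exceptional hD hergodic hx, fun ω hω _ hcluster =>
    Approach.Scheme.mem_closure_of_mapClusterPt hD (hx ω) hK.isBounded hω hcluster⟩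


theorem mainTheorem1 {S Up Ua : Type*} [Fintype S] [Fintype Up] [Fintype Ua]
    [Nonempty S] [Nonempty Up] [Nonempty Ua] {d : ℕ} (G : Approach.Game S Up Ua d)
    (hK : IsCompact G.K)
    (hκ : convexHull ℝ {r | ∃ θ a b, r = G.κ θ a b} ⊆ G.K)
    (hDK : G.D ⊆ G.K) (hD : G.D.Nonempty) (hconv : Convex ℝ (closure G.D))
    (hergodic : G.Ergodic) (hsep : G.Separation) :
    Nonempty (Approach.Scheme G) ∧
    ∀ (C : Approach.Scheme G) {Ω : Type*} [mΩ : MeasurableSpace Ω]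
      (μ : Measure Ω) [IsProbabilityMeasure μ] (ℱ : Filtration ℕ mΩ)
      (x₀ : Approach.Vec d) (θ : ℕ → Ω → S) (up : ℕ → Ω → Up) (ua : ℕ → Ω → Ua)
      (πa : ℕ → Ω → Approach.Strategy S Ua),
      x₀ ∈ G.K → C.IsPlay μ ℱ x₀ θ up ua πa →
        (∀ᵐ ω ∂μ, C.path x₀ θ up ua ω ∉ C.exceptional) ∧
        (∀ ω, C.path x₀ θ up ua ω ∉ C.exceptional →
          ∀ x, MapClusterPt x atTop (C.path x₀ θ up ua ω) → x ∈ closure G.D) := by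
  obtain ⟨hex, h⟩ := mainTheorem1_general G hK hκ hD hconv hergodic hsep
  exact ⟨hex, fun C _ _ μ _ => h C μ⟩
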